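/- **Theorem S1.** Fix the number of factors $r$. Consider an array of models, indexed along a filter (e.g. a sequence), with number of assets $p\to\infty$ and number of observations $T\to\infty$. Each model may live on its own probability space with a filtration $(\mathcal F_t)_{t\ge 0}$, and all its ingredients except $r$ and the constants $q,C,c$ and the function $p\mapsto s_p$ below may vary along the array. *Model.* For $t\ge 1$, $y_t=\mu+Vf_t+u_t\in\mathbb R^p$ with deterministic $\mu\in\mathbb R^p$ and $V\in\mathbb R^{p\times r}$, $V^\top V=pI_r$; $f_t$ and $u_t$ are $\mathcal F_t$-measurable, square integrable and independent of each other, with $\mathbb E[f_{t+1}\mid\mathcal F_t]=0$ and $\mathbb E[u_{t+1}\mid\mathcal F_t]=0$ for $t\ge 0$. The factors follow a GARCH model: $f_{it}=\sqrt{h_{it}}\,\epsilon_{it}$ with $\epsilon_{it}$ i.i.d. (over $i$ and $t$) of mean $0$ and variance $1$, $h_{it}\ge 0$, $h_1$ is $\mathcal F_0$-measurable, and $h_{t+1}=\omega+Af_t^2+Bh_t$ for $t\ge1$, where $f_t^2$ is the elementwise square. For $t\ge 0$, $\mathbb E[f_{t+1}f_{t+1}^\top\mid\mathcal F_t]=\mathrm{Diag}(h_{t+1})$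 and $\mathbb E[(y_{t+1}-\mu)(y_{t+1}-\mu)^\top\mid\mathcal F_t]=V\,\mathrm{Diag}(h_{t+1})V^\top+\Sigma_u$ almost surely, with a deterministic $p\times p$ matrix $\Sigma_u$ that satisfies, for some fixed $q\in[0,1)$, $$\max_{i\le p}\sum_{j=1}^p|\Sigma_{u,ij}|^q(\Sigma_{u,ii}\Sigma_{u,jj})^{(1-q)/2}\le s_p\qquad(0^0:=0),$$ where $s_p=O(p)$ as $p\to\infty$. *Assumptions.* There are constants $C$ and $c>0$, not depending on the model in the array, such that: (a) $\mathbb E[f_{it}^8]$, $\mathbb E[h_{it}^4]$, $\mathbb E[(u_{it}u_{jt}-\Sigma_{u,ij})^4]$ and $\mathbb E[(x^\top u_t/\sqrt{x^\top\Sigma_u x})^4]$ are finite and at most $C$ for all $t\ge1$, all $i,j$ and all $x\in\mathbb R^p$ with $\|x\|=1$ (a quotient with denominator $0$ is read as $0$); (b) with $\bar\Sigma_f=T^{-1}\sum_{t=1}^T\mathrm{Diag}(h_t)$, $\lambda_k$ the $k$-th largest eigenvalue and $\lambda_{r+1}(\bar\Sigma_f):=0$, one has $\min_{k\le r}|\lambda_k(\bar\Sigma_f)-\lambda_{k+1}(\bar\Sigma_f)|\ge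 c$ a.s.; moreover the factors are numbered so that the diagonal entries of $\bar\Sigma_f$ are decreasing a.s. *Estimators.* Let $\bar y=T^{-1}\sum_{t=1}^Ty_t$ and $\widehat\Sigma=T^{-1}\sum_{t=1}^T(y_t-\bar y)(y_t-\bar y)^\top$. Let $\widehat V=\sqrt p\,(\widehat q_1,\dots,\widehat q_r)$, where $\widehat q_1,\dots,\widehat q_p$ is any orthonormal basis of eigenvectors of $\widehat\Sigma$ listed by decreasing eigenvalue, and let $\widehat f_t=p^{-1}\widehat V^\top(y_t-\bar y)$. *Conclusion.* In the spectral norm, $$\min_{O}\|\widehat V-VO\|^2=O_p\Big(\frac pT+\frac{s_p^2}{p}\Big),$$ where $O$ runs over the $r\times r$ diagonal matrices with diagonal entries $\pm1$; and for every choice of time points $t$, possibly varying along the array, with $1\le t\le T$ eventually, in the Euclidean norm, $$\|\widehat f_t^{\,2}-f_t^2\|=O_p\Big(\frac1{\sqrt T}+\sqrt{\frac{s_p}{p}}\Big).$$ -/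

import Mathlib

open MeasureTheory ProbabilityTheory Filter Topology Asymptotics
open scoped Matrix

noncomputable section

section Norms
open scoped Matrix.Norms.L2Operator

/-- The spectral norm of a real matrix: its operator norm between Euclidean spaces. -/
def matSpectralNorm {m n : ℕ} (A : Matrix (Fin m) (Fin n) ℝ) : ℝ := ‖A‖

end Norms

/-- The Euclidean norm of a real vector. -/
def euclNorm {n : ℕ} (x : Fin n → ℝ) : ℝ := ‖WithLp.toLp 2 x‖

/-- The eigenvalues of a square matrix in decreasing order and with multiplicity, indexed from `0`;
the value is `0` once the index exceeds the size of the matrix. For a symmetric real matrix all the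
roots of the characteristic polynomial are real. -/
def eigDesc {n : ℕ} (A : Matrix (Fin n) (Fin n) ℝ) (k : ℕ) : ℝ :=
  (A.charpoly.roots.sort (· ≥ ·)).getD k 0

/-- The power `|x| ^ q` with the convention `0 ^ 0 = 0`. -/
def absPow (x q : ℝ) : ℝ := if x = 0 then 0 else |x| ^ q

/-- `X = O_p(a)` along the filter `l`; the random variables `X i` may live on different probability
spaces. -/
def IsBigOp {ι : Type*} (l : Filter ι) {Ω : ι → Type*} [∀ i, MeasurableSpace (Ω i)]
    (P : ∀ i, Measure (Ω i)) (X : ∀ i, Ω i → ℝ) (a : ι → ℝ) : Prop :=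
  ∀ ε : ℝ, 0 < ε → ∃ K : ℝ, ∀ᶠ i in l, P i {ω | K * a i < |X i ω|} ≤ ENNReal.ofReal ε

/-- The `k`-th moment of `X` exists and is at most `C`. -/
def MomentLE {Ω : Type*} [MeasurableSpace Ω] (P : Measure Ω) (X : Ω → ℝ) (k : ℕ) (C : ℝ) : Prop :=
  Integrable (fun ω => X ω ^ k) P ∧ ∫ ω, X ω ^ k ∂P ≤ C

/-- The latent factor model `y_t = μ + V f_t + u_t` for `p` assets with `r` GARCH factors, at the
times `t = 1, 2, …`; values of the processes at time `0` play no role. -/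
structure FactorModel (r p : ℕ) (Ω : Type*) [mΩ : MeasurableSpace Ω] (P : Measure Ω) where
  /-- the constant mean vector -/
  mean : Fin p → ℝ
  /-- the factor loading matrix -/
  V : Matrix (Fin p) (Fin r) ℝ
  /-- the idiosyncratic volatility matrix -/
  SigmaU : Matrix (Fin p) (Fin p) ℝ
  /-- the GARCH intercept -/
  omega : Fin r → ℝ
  /-- the GARCH coefficient of the squared factors -/
  A : Matrix (Fin r) (Fin r) ℝ
  /-- the GARCH coefficient of the past volatilities -/
  B : Matrix (Fin r) (Fin r) ℝ
  /-- the information available at each time -/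
  info : Filtration ℕ mΩ
  /-- the innovations -/
  eps : ℕ → Ω → Fin r → ℝ
  /-- the conditional factor variances -/
  h : ℕ → Ω → Fin r → ℝ
  /-- the latent factors -/
  f : ℕ → Ω → Fin r → ℝ
  /-- the idiosyncratic components -/
  u : ℕ → Ω → Fin p → ℝ
  /-- the observed log returns -/
  y : ℕ → Ω → Fin p → ℝ
  -- measurability
  eps_meas : ∀ t, Measurable (eps (t + 1))
  h_meas : Measurable[info 0] (h 1)
  f_meas : ∀ t, Measurable[info (t + 1)] (f (t + 1))
  u_meas : ∀ t, Measurable[info (t + 1)] (u (t + 1))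
  f_memLp : ∀ t k, MemLp (fun ω => f (t + 1) ω k) 2 P
  u_memLp : ∀ t i, MemLp (fun ω => u (t + 1) ω i) 2 P
  -- the factor structure, with independent factor and idiosyncratic component
  y_eq : ∀ t ω, y (t + 1) ω = mean + V *ᵥ f (t + 1) ω + u (t + 1) ω
  indep : ∀ t, IndepFun (f (t + 1)) (u (t + 1)) P
  -- normalization of the loadings
  V_norm : Vᵀ * V = (p : ℝ) • (1 : Matrix (Fin r) (Fin r) ℝ)
  -- the innovations are i.i.d. over time and over factors, with mean zero and unit variance
  eps_iIndep : iIndepFun (fun (x : ℕ × Fin r) ω => eps (x.1 + 1) ω x.2) P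
  eps_ident : ∀ x x' : ℕ × Fin r,
    IdentDistrib (fun ω => eps (x.1 + 1) ω x.2) (fun ω => eps (x'.1 + 1) ω x'.2) P P
  eps_memLp : ∀ t k, MemLp (fun ω => eps (t + 1) ω k) 2 P
  eps_mean : ∀ t k, ∫ ω, eps (t + 1) ω k ∂P = 0
  eps_var : ∀ t k, ∫ ω, eps (t + 1) ω k ^ 2 ∂P = 1
  -- the GARCH dynamics
  h_nonneg : ∀ t ω k, 0 ≤ h (t + 1) ω k
  f_eq : ∀ t ω k, f (t + 1) ω k = √(h (t + 1) ω k) * eps (t + 1) ω k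
  h_eq : ∀ t ω, h (t + 2) ω =
    omega + A *ᵥ (fun k => f (t + 1) ω k ^ 2) + B *ᵥ h (t + 1) ω
  -- conditional means, and the conditional second moments of the factors and of the returns
  f_condMean : ∀ t k, P[fun ω => f (t + 1) ω k | info t] =ᵐ[P] 0
  u_condMean : ∀ t i, P[fun ω => u (t + 1) ω i | info t] =ᵐ[P] 0
  f_condCov : ∀ t k l, P[fun ω => f (t + 1) ω k * f (t + 1) ω l | info t] =ᵐ[P]
    fun ω => Matrix.diagonal (h (t + 1) ω) k l
  y_condCov : ∀ t i j,
    P[fun ω => (y (t + 1) ω i - mean i) * (y (t + 1) ω j - mean j) | info t] =ᵐ[P]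
      fun ω => (V * Matrix.diagonal (h (t + 1) ω) * Vᵀ + SigmaU) i j

namespace FactorModel

variable {r p : ℕ} {Ω : Type*} [MeasurableSpace Ω] {P : Measure Ω}

/-- The sparsity condition on the idiosyncratic volatility matrix. -/
def Sparse (M : FactorModel r p Ω P) (q s : ℝ) : Prop :=
  ∀ i, ∑ j, absPow (M.SigmaU i j) q * (M.SigmaU i i * M.SigmaU j j) ^ ((1 - q) / 2) ≤ s

/-- The moment conditions, with bound `C`. -/
def Moments (M : FactorModel r p Ω P) (C : ℝ) : Prop :=
  (∀ t k, MomentLE P (fun ω => M.f (t + 1) ω k) 8 C) ∧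
  (∀ t k, MomentLE P (fun ω => M.h (t + 1) ω k) 4 C) ∧
  (∀ t i j, MomentLE P (fun ω => M.u (t + 1) ω i * M.u (t + 1) ω j - M.SigmaU i j) 4 C) ∧
  (∀ t (q : Fin p → ℝ), euclNorm q = 1 →
    MomentLE P (fun ω => (q ⬝ᵥ M.u (t + 1) ω) / √(q ⬝ᵥ (M.SigmaU *ᵥ q))) 4 C)

/-- The mean conditional factor volatility matrix over the times `1, …, T`. -/
def SigmaFBar (M : FactorModel r p Ω P) (T : ℕ) (ω : Ω) : Matrix (Fin r) (Fin r) ℝ :=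
  (T : ℝ)⁻¹ • ∑ t ∈ Finset.Icc 1 T, Matrix.diagonal (M.h t ω)

/-- The eigen-gap condition, including the gap between the smallest eigenvalue and `0`. -/
def EigenGap (M : FactorModel r p Ω P) (T : ℕ) (c : ℝ) : Prop :=
  ∀ᵐ ω ∂P, ∀ k < r, c ≤ |eigDesc (M.SigmaFBar T ω) k - eigDesc (M.SigmaFBar T ω) (k + 1)|

/-- The factors are numbered by decreasing mean conditional variance. -/
def Ordered (M : FactorModel r p Ω P) (T : ℕ) : Prop :=
  ∀ᵐ ω ∂P, Antitone fun k => M.SigmaFBar T ω k k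

/-- The sample mean of the returns. -/
def yBar (M : FactorModel r p Ω P) (T : ℕ) (ω : Ω) : Fin p → ℝ :=
  (T : ℝ)⁻¹ • ∑ t ∈ Finset.Icc 1 T, M.y t ω

/-- The sample covariance matrix of the returns. -/
def sampleCov (M : FactorModel r p Ω P) (T : ℕ) (ω : Ω) : Matrix (Fin p) (Fin p) ℝ :=
  (T : ℝ)⁻¹ • ∑ t ∈ Finset.Icc 1 T,
    Matrix.vecMulVec (M.y t ω - M.yBar T ω) (M.y t ω - M.yBar T ω)

/-- The estimated factor at time `t` for the loading estimate `W`. -/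
def fHat (M : FactorModel r p Ω P) (T : ℕ) (W : Matrix (Fin p) (Fin r) ℝ) (t : ℕ) (ω : Ω) :
    Fin r → ℝ :=
  (p : ℝ)⁻¹ • (Wᵀ *ᵥ (M.y t ω - M.yBar T ω))

end FactorModel

/-- `W` is `√p` times the matrix of the first `r` columns of some orthogonal matrix `Q` whose columns
are eigenvectors of `S`, listed by decreasing eigenvalue. -/
def IsPCALoading {r p : ℕ} (S : Matrix (Fin p) (Fin p) ℝ) (W : Matrix (Fin p) (Fin r) ℝ) : Prop :=
  ∃ (hrp : r ≤ p) (lam : Fin p → ℝ) (Q : Matrix (Fin p) (Fin p) ℝ),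
    Antitone lam ∧ Qᵀ * Q = 1 ∧ S = Q * Matrix.diagonal lam * Qᵀ ∧
    ∀ i k, W i k = √(p : ℝ) * Q i (Fin.castLE hrp k)

/-- The minimum over the diagonal sign matrices `O` of `‖W - V O‖ ^ 2`. -/
def signedSqDist {r p : ℕ} (W V : Matrix (Fin p) (Fin r) ℝ) : ℝ :=
  ⨅ σ : Fin r → ℤˣ, matSpectralNorm (W - V * Matrix.diagonal fun k => ((σ k : ℤ) : ℝ)) ^ 2

end

/-! The sample covariance matrix is a perturbation of `V * diagonal (hBar) * Vᵀ`. Since `Vᵀ * V = p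
• 1`, the latter has the normalized columns of `V` as eigenvectors, with eigenvalues `p * hBar k`,
and the eigen-gap condition separates these from each other and from the remaining zeros by at least
`p * c`. The difference is exactly `SigmaU` plus the time average of a matrix martingale difference
minus a rank-one matrix from the sample mean (`FactorModel.sampleCov_sub_eq`).

The three pieces have spectral norm of order `s`, `p / √T` and `p / T`. The first bound is the Schur
test: Cauchy-Schwarz turns the sparsity condition into a bound on absolute row sums. The other two
come from orthogonality of martingale differences and Markov's inequality, once the trace of
`SigmaU` is known to be `O(p)`. No bound on single variances is assumed; the trace bound comes from
`Moments.diag_mul_diag_le`: two large variances force a large covariance, and sparsity limits the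
covariances. With `e` the total perturbation, Davis-Kahan (`exists_sign_norm_sub_le`), scaled by
`√p`, bounds the squared loading error by a multiple of `e ^ 2 / p`, that is, of `p / T + s ^ 2 /
p`.

The factor error splits into the loading error acting on the common and idiosyncratic components,
the projection of `u` on the true loadings, whose mean square is at most `p * s` per factor, and the
sample mean. Squaring removes the sign ambiguity. -/

noncomputable section

/-! ### Perturbation of eigenvalues and eigenvectors. -/

section Spectral

variable {n : ℕ} {E : Type*} [NormedAddCommGroup E] [InnerProductSpace ℝ E]

lemma OrthonormalBasis.sum_sq_inner (b : OrthonormalBasis (Fin n) ℝ E) (x : E) :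
    ∑ i, inner ℝ (b i) x ^ 2 = ‖x‖ ^ 2 := by
  simpa using b.sum_sq_norm_inner_right x

lemma OrthonormalBasis.map_eq_sum_of_eigen (b : OrthonormalBasis (Fin n) ℝ E) {A : E →ₗ[ℝ] E}
    {d : Fin n → ℝ} (hA : ∀ i, A (b i) = d i • b i) (x : E) :
    A x = ∑ i, (d i * inner ℝ (b i) x) • b i := by
  conv_lhs => rw [← b.sum_repr' x, map_sum]
  exact Finset.sum_congr rfl fun i _ => by rw [map_smul, hA, smul_smul, mul_comm]

lemma OrthonormalBasis.inner_map_eq_sum_of_eigen (b : OrthonormalBasis (Fin n) ℝ E)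
    {A : E →ₗ[ℝ] E} {d : Fin n → ℝ} (hA : ∀ i, A (b i) = d i • b i) (x : E) :
    inner ℝ x (A x) = ∑ i, d i * inner ℝ (b i) x ^ 2 := by
  rw [b.map_eq_sum_of_eigen hA, inner_sum]
  exact Finset.sum_congr rfl fun i _ => by
    rw [real_inner_smul_right, real_inner_comm]; ring

/-- A nonzero vector orthogonal to the first `k` vectors of one basis and to the vectors after the
`k`-th of another one. -/
lemma OrthonormalBasis.exists_ne_zero_inner_eq_zero (b q : OrthonormalBasis (Fin n) ℝ E)
    (k : Fin n) : ∃ x : E, x ≠ 0 ∧ (∀ j < k, inner ℝ (b j) x = 0) ∧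
      ∀ j > k, inner ℝ (q j) x = 0 := by
  have : FiniteDimensional ℝ E := b.toBasis.finiteDimensional_of_finite
  -- Coordinate `k` of `L` is zero, so `L` is not onto; the dimensions agree, so it has a kernel.
  let L : E →ₗ[ℝ] (Fin n → ℝ) := LinearMap.pi fun j =>
    if j < k then innerₛₗ ℝ (b j) else if k < j then innerₛₗ ℝ (q j) else 0
  have hfin : Module.finrank ℝ E = Module.finrank ℝ (Fin n → ℝ) := by
    rw [Module.finrank_eq_card_basis b.toBasis]; simp
  have hns : ¬ Function.Injective L := by
    rw [LinearMap.injective_iff_surjective_of_finrank_eq_finrank hfin]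
    intro hs
    obtain ⟨x, hx⟩ := hs (Pi.single k 1)
    have := congrFun hx k
    simp [L] at this
  rw [injective_iff_map_eq_zero] at hns
  push Not at hns
  obtain ⟨x, hx, hx0⟩ := hns
  refine ⟨x, hx0, fun j hj => ?_, fun j hj => ?_⟩
  · simpa [L, hj] using congrFun hx j
  · simpa [L, hj, hj.le, not_lt_of_gt hj] using congrFun hx j

/-- One half of Weyl's inequality. -/
lemma eigenvalue_le_add (b q : OrthonormalBasis (Fin n) ℝ E) {A B : E →ₗ[ℝ] E}
    {lam d : Fin n → ℝ} (hA : ∀ i, A (q i) = lam i • q i) (hB : ∀ i, B (b i) = d i • b i)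
    (hlam : Antitone lam) (hd : Antitone d) {e : ℝ} (he : ∀ x, ‖A x - B x‖ ≤ e * ‖x‖) (k : Fin n) :
    lam k ≤ d k + e := by
  obtain ⟨x, hx0, hxb, hxq⟩ := b.exists_ne_zero_inner_eq_zero q k
  -- Courant-Fischer: on this `x` the form of `A` only sees eigenvalues at least `lam k`, and that
  -- of `B` only those at most `d k`.
  have h1 : lam k * ‖x‖ ^ 2 ≤ inner ℝ x (A x) := by
    rw [q.inner_map_eq_sum_of_eigen hA, ← q.sum_sq_inner, Finset.mul_sum]
    refine Finset.sum_le_sum fun i _ => ?_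
    rcases le_or_gt i k with h | h
    · exact mul_le_mul_of_nonneg_right (hlam h) (sq_nonneg _)
    · simp [hxq i h]
  have h2 : inner ℝ x (B x) ≤ d k * ‖x‖ ^ 2 := by
    rw [b.inner_map_eq_sum_of_eigen hB, ← b.sum_sq_inner, Finset.mul_sum]
    refine Finset.sum_le_sum fun i _ => ?_
    rcases lt_or_ge i k with h | h
    · simp [hxb i h]
    · exact mul_le_mul_of_nonneg_right (hd h) (sq_nonneg _)
  have h3 : inner ℝ x (A x) - inner ℝ x (B x) ≤ e * ‖x‖ ^ 2 := by
    rw [← inner_sub_right]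
    calc _ ≤ ‖x‖ * ‖A x - B x‖ := real_inner_le_norm _ _
      _ ≤ ‖x‖ * (e * ‖x‖) := by gcongr; exact he x
      _ = _ := by ring
  have hpos : 0 < ‖x‖ ^ 2 := by positivity
  nlinarith

/-- A form of the Davis-Kahan theorem for simple eigenvalues. -/
lemma exists_sign_norm_sub_le (b q : OrthonormalBasis (Fin n) ℝ E) {A B : E →ₗ[ℝ] E}
    {lam d : Fin n → ℝ} (hA : ∀ i, A (q i) = lam i • q i) (hB : ∀ i, B (b i) = d i • b i)
    (hlam : Antitone lam) (hd : Antitone d) {e : ℝ} (he : ∀ x, ‖A x - B x‖ ≤ e * ‖x‖) (k : Fin n)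
    {g : ℝ} (hg : 0 < g) (hgap : ∀ j ≠ k, g ≤ |d j - d k|) :
    ∃ σ : ℤˣ, ‖q k - ((σ : ℤ) : ℝ) • b k‖ ^ 2 ≤ 8 * e ^ 2 / g ^ 2 := by
  have hw : |lam k - d k| ≤ e := by
    rw [abs_le]
    have h1 := eigenvalue_le_add b q hA hB hlam hd he k
    have h2 := eigenvalue_le_add q b hB hA hd hlam (e := e)
      (fun x => by rw [norm_sub_rev]; exact he x) k
    constructor <;> linarith
  -- One `e` from replacing `A` by `B`, one from replacing `lam k` by `d k`.
  have hres : ‖B (q k) - d k • q k‖ ≤ 2 * e := by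
    have h1 : B (q k) - d k • q k = -(A (q k) - B (q k)) + (lam k - d k) • q k := by
      rw [hA, sub_smul]; abel
    have h2 := he (q k)
    rw [h1]
    refine (norm_add_le _ _).trans ?_
    rw [norm_neg, norm_smul, Real.norm_eq_abs]
    simp only [q.norm_eq_one, mul_one] at h2 ⊢
    linarith
  have he0 : 0 ≤ e := (abs_nonneg _).trans hw
  set z := inner ℝ (b k) (q k) with hz
  have hsum : ∑ j, inner ℝ (b j) (q k) ^ 2 = 1 := by simp [b.sum_sq_inner]
  -- In the basis `b` the residual has coefficients `(d j - d k) * inner ℝ (b j) (q k)`, so the gap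
  -- bounds the mass of `q k` off `b k`.
  have hperp : g ^ 2 * (1 - z ^ 2) ≤ (2 * e) ^ 2 := by
    calc g ^ 2 * (1 - z ^ 2) = ∑ j ∈ Finset.univ.erase k, g ^ 2 * inner ℝ (b j) (q k) ^ 2 := by
          rw [← hsum, ← Finset.mul_sum, ← Finset.add_sum_erase _ _ (Finset.mem_univ k)]; ring
      _ ≤ ∑ j ∈ Finset.univ.erase k, inner ℝ (b j) (B (q k) - d k • q k) ^ 2 := by
          refine Finset.sum_le_sum fun j hj => ?_
          have h1 : inner ℝ (b j) (B (q k)) = d j * inner ℝ (b j) (q k) := by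
            rw [b.map_eq_sum_of_eigen hB, b.orthonormal.inner_right_fintype]
          rw [inner_sub_right, h1, real_inner_smul_right, ← sub_mul, mul_pow]
          refine mul_le_mul_of_nonneg_right ?_ (sq_nonneg _)
          rw [← sq_abs (d j - d k)]
          exact pow_le_pow_left₀ hg.le (hgap j (Finset.ne_of_mem_erase hj)) 2
      _ ≤ ∑ j, inner ℝ (b j) (B (q k) - d k • q k) ^ 2 :=
          Finset.sum_le_sum_of_subset_of_nonneg (Finset.subset_univ _) fun _ _ _ => sq_nonneg _
      _ = ‖B (q k) - d k • q k‖ ^ 2 := b.sum_sq_inner _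
      _ ≤ (2 * e) ^ 2 := pow_le_pow_left₀ (norm_nonneg _) hres 2
  have hz1 : z ^ 2 ≤ 1 := by
    rw [← hsum]; exact Finset.single_le_sum (f := fun j => inner ℝ (b j) (q k) ^ 2)
      (fun _ _ => sq_nonneg _) (Finset.mem_univ k)
  -- With the sign making `0 ≤ s * z ≤ 1`, the squared distance `2 - 2 * (s * z)` is at most `2 * (1
  -- - z ^ 2)`; with `hperp` this gives the factor `2 * 4 = 8`.
  have hmain : ∀ s : ℝ, s ^ 2 = 1 → 0 ≤ s * z → ‖q k - s • b k‖ ^ 2 ≤ 8 * e ^ 2 / g ^ 2 := by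
    intro s hs hsz
    have h1 : ‖q k - s • b k‖ ^ 2 = 2 - 2 * (s * z) := by
      rw [norm_sub_sq_real, norm_smul, real_inner_smul_right, real_inner_comm]
      simp only [q.norm_eq_one, b.norm_eq_one, mul_one, Real.norm_eq_abs, sq_abs, hs]
      ring
    rw [h1, le_div_iff₀ (by positivity)]
    have h2 : (s * z) ^ 2 = z ^ 2 := by rw [mul_pow, hs, one_mul]
    have h3 : s * z ≤ 1 := by nlinarith
    have h4 : (2 - 2 * (s * z)) ≤ 2 * (1 - z ^ 2) := by nlinarith
    nlinarith [sq_nonneg g]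
  rcases le_total 0 z with h | h
  · exact ⟨1, by simpa using hmain 1 (by norm_num) (by simpa using h)⟩
  · exact ⟨-1, by simpa using hmain (-1) (by norm_num) (by simpa using h)⟩

end Spectral

/-! ### Principal component loadings, ordered eigenvalues and the sign-adjusted distance. -/

section Loadings

variable {r p : ℕ}

/-- The orthonormal basis of the columns of an orthogonal matrix. -/
lemma exists_orthonormalBasis_of_transpose_mul_self {Q : Matrix (Fin p) (Fin p) ℝ}
    (hQ : Qᵀ * Q = 1) : ∃ b : OrthonormalBasis (Fin p) ℝ (EuclideanSpace ℝ (Fin p)),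
      ∀ k, b k = WithLp.toLp 2 (fun i => Q i k) := by
  have h : Orthonormal ℝ fun k => (WithLp.toLp 2 (fun i => Q i k) : EuclideanSpace ℝ (Fin p)) := by
    rw [orthonormal_iff_ite]
    intro i j
    have := congrFun (congrFun hQ i) j
    rw [Matrix.mul_apply, Matrix.one_apply] at this
    rw [← this, PiLp.inner_apply]
    exact Finset.sum_congr rfl fun l _ => by simp [mul_comm]
  obtain ⟨b, hb⟩ := Orthonormal.exists_orthonormalBasis_extension_of_card_eq (𝕜 := ℝ)
    (E := EuclideanSpace ℝ (Fin p)) (ι := Fin p) (by simp) (s := Set.univ)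
    (v := fun k => WithLp.toLp 2 (fun i => Q i k))
    (h.comp Subtype.val Subtype.val_injective)
  exact ⟨b, fun k => hb k trivial⟩

lemma toEuclideanLin_mul_diagonal_mul_transpose_apply {m : ℕ} (Q : Matrix (Fin p) (Fin m) ℝ)
    (lam : Fin m → ℝ) (x : EuclideanSpace ℝ (Fin p)) :
    Matrix.toEuclideanLin (Q * Matrix.diagonal lam * Qᵀ) x =
      ∑ k, (lam k * inner ℝ (WithLp.toLp 2 (fun i => Q i k)) x) •
        (WithLp.toLp 2 (fun i => Q i k) : EuclideanSpace ℝ (Fin p)) := by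
  have : ∀ k, inner ℝ (WithLp.toLp 2 (fun i => Q i k)) x = (Qᵀ *ᵥ x.ofLp) k := by
    intro k
    simp [PiLp.inner_apply, Matrix.mulVec, dotProduct, mul_comm]
  ext i
  have hdiag : ∀ y : Fin m → ℝ, Matrix.diagonal lam *ᵥ y = fun k => lam k * y k :=
    fun y => funext (Matrix.mulVec_diagonal _ _)
  simp only [this, Matrix.toLpLin_apply, ← Matrix.mulVec_mulVec, hdiag]
  simp [Matrix.mulVec, dotProduct, mul_comm]

/-- Perturbation bound for the loadings estimated by principal components. -/
lemma IsPCALoading.exists_sign_sum_sq_le {S : Matrix (Fin p) (Fin p) ℝ}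
    {W V : Matrix (Fin p) (Fin r) ℝ} (hW : IsPCALoading S W) (hp : 0 < p)
    (hV : Vᵀ * V = (p : ℝ) • (1 : Matrix (Fin r) (Fin r) ℝ)) {d : Fin r → ℝ} (hd : Antitone d)
    {c : ℝ} (hc : 0 < c) (hgap : ∀ j k, j ≠ k → c ≤ |d j - d k|) (hdc : ∀ k, c ≤ d k) {e : ℝ}
    (he : ∀ x, ‖Matrix.toEuclideanLin (S - V * Matrix.diagonal d * Vᵀ) x‖ ≤ e * ‖x‖) :
    ∃ σ : Fin r → ℤˣ, ∀ k, ∑ i, (W i k - ((σ k : ℤ) : ℝ) * V i k) ^ 2 ≤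
      8 * e ^ 2 / (c ^ 2 * p) := by
  obtain ⟨hrp, lam, Q, hlam, hQ, rfl, hWQ⟩ := hW
  have hp' : (0 : ℝ) < p := by exact_mod_cast hp
  have hsp : 0 < √(p : ℝ) := Real.sqrt_pos.2 hp'
  obtain ⟨q, hq⟩ := exists_orthonormalBasis_of_transpose_mul_self hQ
  let w : Fin r → EuclideanSpace ℝ (Fin p) := fun k => WithLp.toLp 2 (fun i => V i k)
  have hw : ∀ j k, inner ℝ (w j) (w k) = if j = k then (p : ℝ) else 0 := by
    intro j k
    have := congrFun (congrFun hV j) k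
    rw [Matrix.mul_apply, Matrix.smul_apply, Matrix.one_apply, smul_eq_mul, mul_ite, mul_one,
      mul_zero] at this
    rw [← this, PiLp.inner_apply]
    exact Finset.sum_congr rfl fun l _ => by simp [w, mul_comm]
  -- The zero vectors are placeholders: only the first `r` entries are kept when extending to an
  -- orthonormal basis.
  let v : Fin p → EuclideanSpace ℝ (Fin p) := fun k =>
    if h : (k : ℕ) < r then (√(p : ℝ))⁻¹ • w ⟨k, h⟩ else 0
  have hv : Orthonormal ℝ (Set.domRestrict {k : Fin p | (k : ℕ) < r} v) := by
    rw [orthonormal_iff_ite]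
    rintro ⟨i, hi⟩ ⟨j, hj⟩
    have hi' : (i : ℕ) < r := hi
    have hj' : (j : ℕ) < r := hj
    simp only [Set.domRestrict_apply, v, hi', hj', dif_pos, real_inner_smul_left,
      real_inner_smul_right, hw, Subtype.mk.injEq, Fin.ext_iff]
    split_ifs
    · rw [← mul_assoc, ← mul_inv, Real.mul_self_sqrt hp'.le, inv_mul_cancel₀ hp'.ne']
    · simp
  obtain ⟨b, hb⟩ := Orthonormal.exists_orthonormalBasis_extension_of_card_eq (𝕜 := ℝ)
    (E := EuclideanSpace ℝ (Fin p)) (ι := Fin p) (by simp) hv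
  have hb' : ∀ (k : Fin p) (h : (k : ℕ) < r), w ⟨k, h⟩ = √(p : ℝ) • b k := by
    intro k h
    rw [hb k h]
    simp only [v, h, dif_pos]
    rw [smul_smul, mul_inv_cancel₀ hsp.ne', one_smul]
  -- The full spectrum of `V * diagonal d * Vᵀ`. The bound `hdc` keeps it decreasing and separates
  -- the first `r` values from the zeros.
  let D : Fin p → ℝ := fun k => if h : (k : ℕ) < r then p * d ⟨k, h⟩ else 0
  have hD : Antitone D := by
    intro i j hij
    by_cases hj : (j : ℕ) < r
    · have hi : (i : ℕ) < r := lt_of_le_of_lt hij hj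
      simp only [D, hi, hj, dif_pos]
      exact mul_le_mul_of_nonneg_left (hd (by simpa using hij)) hp'.le
    · by_cases hi : (i : ℕ) < r
      · simp only [D, hi, hj, dif_pos, dif_neg, not_false_eq_true]
        exact mul_nonneg hp'.le (hc.le.trans (hdc _))
      · simp [D, hi, hj]
  have hA : ∀ i, Matrix.toEuclideanLin (Q * Matrix.diagonal lam * Qᵀ) (q i) = lam i • q i := by
    intro i
    rw [toEuclideanLin_mul_diagonal_mul_transpose_apply]
    simp only [← hq, orthonormal_iff_ite.1 q.orthonormal]
    simp [mul_ite, ite_smul]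
  have hB : ∀ i, Matrix.toEuclideanLin (V * Matrix.diagonal d * Vᵀ) (b i) = D i • b i := by
    intro i
    rw [toEuclideanLin_mul_diagonal_mul_transpose_apply]
    change ∑ k, (d k * inner ℝ (w k) (b i)) • w k = _
    have h1 : ∀ k : Fin r, w k = √(p : ℝ) • b (Fin.castLE hrp k) := fun k =>
      hb' (Fin.castLE hrp k) k.2
    simp only [h1, real_inner_smul_left, orthonormal_iff_ite.1 b.orthonormal, D]
    split_ifs with h
    · rw [Finset.sum_eq_single ⟨i, h⟩]
      · have : Fin.castLE hrp ⟨i, h⟩ = i := rfl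
        rw [this, if_pos rfl, smul_smul]
        congr 1
        rw [mul_one, mul_assoc, Real.mul_self_sqrt hp'.le, mul_comm]
      · intro k _ hk
        rw [if_neg, mul_zero, mul_zero, zero_smul]
        rintro rfl
        exact hk rfl
      · simp
    · rw [zero_smul]
      refine Finset.sum_eq_zero fun k _ => ?_
      rw [if_neg, mul_zero, mul_zero, zero_smul]
      rintro rfl
      exact h k.2
  have key : ∀ k : Fin r, ∃ σ : ℤˣ, ∑ i, (W i k - ((σ : ℤ) : ℝ) * V i k) ^ 2 ≤
      8 * e ^ 2 / (c ^ 2 * p) := by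
    intro k
    obtain ⟨σ, hσ⟩ := exists_sign_norm_sub_le b q hA hB hlam hD (e := e)
      (fun x => by rw [← LinearMap.sub_apply, ← map_sub]; exact he x)
      (Fin.castLE hrp k) (g := p * c) (by positivity) (by
        intro j hj
        have hk : ((Fin.castLE hrp k : Fin p) : ℕ) < r := k.2
        by_cases h : (j : ℕ) < r
        · simp only [D, h, hk, dif_pos, ← mul_sub, abs_mul, abs_of_pos hp']
          refine mul_le_mul_of_nonneg_left (hgap _ _ ?_) hp'.le
          intro h'
          exact hj (Fin.ext (by simpa [Fin.ext_iff] using h'))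
        · simp only [D, h, hk, dif_pos, dif_neg, not_false_eq_true, zero_sub, abs_neg, abs_mul,
            abs_of_pos hp']
          exact mul_le_mul_of_nonneg_left ((hdc _).trans (le_abs_self _)) hp'.le)
    refine ⟨σ, ?_⟩
    have h1 : ∑ i, (W i k - ((σ : ℤ) : ℝ) * V i k) ^ 2 =
        ‖√(p : ℝ) • (q (Fin.castLE hrp k) - ((σ : ℤ) : ℝ) • b (Fin.castLE hrp k))‖ ^ 2 := by
      rw [smul_sub, smul_comm (√(p : ℝ)), ← hb' (Fin.castLE hrp k) k.2, hq,
        EuclideanSpace.norm_sq_eq]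
      refine Finset.sum_congr rfl fun i _ => ?_
      rw [Real.norm_eq_abs, sq_abs, hWQ]
      rfl
    rw [h1, norm_smul, mul_pow, Real.norm_eq_abs, sq_abs, Real.sq_sqrt hp'.le]
    calc _ ≤ (p : ℝ) * (8 * e ^ 2 / (p * c) ^ 2) := by gcongr
      _ = _ := by field_simp
  choose σ hσ using key
  exact ⟨σ, hσ⟩

lemma eigDesc_diagonal {d : Fin r → ℝ} (hd : Antitone d) (k : ℕ) :
    eigDesc (Matrix.diagonal d) k = if h : k < r then d ⟨k, h⟩ else 0 := by
  have hroots : (Matrix.diagonal d).charpoly.roots = ↑(List.ofFn d) := by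
    rw [Matrix.charpoly_diagonal, Polynomial.roots_prod _ _
      (Finset.prod_ne_zero_iff.2 fun i _ => Polynomial.X_sub_C_ne_zero _)]
    simp only [Polynomial.roots_X_sub_C, Multiset.bind_singleton]
    rw [List.ofFn_eq_map, ← Multiset.map_coe]
    rfl
  have hsort : (Matrix.diagonal d).charpoly.roots.sort (· ≥ ·) = List.ofFn d := by
    refine List.Perm.eq_of_pairwise (le := (· ≥ ·)) (fun a b _ _ h1 h2 => le_antisymm h2 h1)
      (Multiset.pairwise_sort _ _) ?_ ?_
    · rw [List.pairwise_ofFn]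
      exact fun i j hij => hd hij.le
    · rw [← Multiset.coe_eq_coe, Multiset.sort_eq, hroots]
  rw [eigDesc, hsort]
  split_ifs with h
  · rw [List.getD_eq_getElem _ _ (by simpa using h)]; simp
  · exact List.getD_eq_default _ _ (by simpa using h)

/-- Consecutive gaps of a decreasing sequence, the last one to zero, bound all gaps. -/
lemma gaps_of_consecutive_gaps {d : Fin r → ℝ} (hd : Antitone d) {c : ℝ}
    (hd0 : ∀ k, 0 ≤ d k)
    (hgap : ∀ k < r, c ≤ |eigDesc (Matrix.diagonal d) k - eigDesc (Matrix.diagonal d) (k + 1)|) :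
    (∀ j k, j ≠ k → c ≤ |d j - d k|) ∧ ∀ k, c ≤ d k := by
  have hlt : ∀ j k : Fin r, j < k → c ≤ d j - d k := by
    intro j k hjk
    have h1 := hgap j j.2
    have hj1 : (j : ℕ) + 1 < r := lt_of_le_of_lt hjk k.2
    rw [eigDesc_diagonal hd, eigDesc_diagonal hd, dif_pos j.2, dif_pos hj1, abs_of_nonneg] at h1
    · have : d k ≤ d ⟨j + 1, hj1⟩ := hd (by rw [Fin.le_def]; exact hjk)
      linarith
    · exact sub_nonneg.2 (hd (by rw [Fin.le_def]; simp))
  refine ⟨fun j k hjk => ?_, fun k => ?_⟩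
  · rcases lt_or_gt_of_ne hjk with h | h
    · exact (hlt j k h).trans (le_abs_self _)
    · rw [abs_sub_comm]; exact (hlt k j h).trans (le_abs_self _)
  -- The last gap compares with index `r`, where `eigDesc` takes its default value `0`, and so
  -- bounds the smallest entry from below.
  · have hr : r - 1 < r := Nat.sub_lt (Fin.pos k) one_pos
    have h1 := hgap (r - 1) hr
    rw [eigDesc_diagonal hd, eigDesc_diagonal hd, dif_pos hr, dif_neg (by omega), sub_zero,
      abs_of_nonneg (hd0 _)] at h1
    exact h1.trans (hd (by rw [Fin.le_def]; exact Nat.le_sub_one_of_lt k.2))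

section Norms
open scoped Matrix.Norms.L2Operator

/-- Passing to the Frobenius norm lets each column be treated separately; with `r` columns this only
costs a constant. -/
lemma matSpectralNorm_sq_le_sum_sq {m n : ℕ} (A : Matrix (Fin m) (Fin n) ℝ) :
    matSpectralNorm A ^ 2 ≤ ∑ k, ∑ i, A i k ^ 2 := by
  have h : matSpectralNorm A ≤ √(∑ k, ∑ i, A i k ^ 2) := by
    rw [matSpectralNorm, Matrix.l2_opNorm_def]
    refine ContinuousLinearMap.opNorm_le_bound _ (Real.sqrt_nonneg _) fun x => ?_
    rw [← Real.sqrt_sq (norm_nonneg x), ← Real.sqrt_mul (by positivity)]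
    refine Real.le_sqrt_of_sq_le ?_
    rw [EuclideanSpace.norm_sq_eq, EuclideanSpace.norm_sq_eq, Finset.sum_comm, Finset.sum_mul]
    refine Finset.sum_le_sum fun i _ => ?_
    simp only [Real.norm_eq_abs, sq_abs]
    exact Finset.sum_mul_sq_le_sq_mul_sq Finset.univ (fun k => A i k) (fun k => x k)
  calc _ ≤ √(∑ k, ∑ i, A i k ^ 2) ^ 2 :=
        pow_le_pow_left₀ (by rw [matSpectralNorm]; exact norm_nonneg _) h 2
    _ = _ := Real.sq_sqrt (by positivity)

end Norms

lemma signedSqDist_nonneg (W V : Matrix (Fin p) (Fin r) ℝ) : 0 ≤ signedSqDist W V :=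
  Real.iInf_nonneg fun _ => sq_nonneg _

lemma signedSqDist_le_sum_sq (W V : Matrix (Fin p) (Fin r) ℝ) (σ : Fin r → ℤˣ) :
    signedSqDist W V ≤ ∑ k, ∑ i, (W i k - ((σ k : ℤ) : ℝ) * V i k) ^ 2 := by
  refine (ciInf_le (Set.finite_range _).bddBelow σ).trans
    ((matSpectralNorm_sq_le_sum_sq _).trans_eq ?_)
  simp [Matrix.sub_apply, Matrix.mul_diagonal, mul_comm]

end Loadings

/-! ### Moment inequalities and martingale differences. -/

section Moments

variable {Ω : Type*} [mΩ : MeasurableSpace Ω] {P : Measure Ω}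

lemma MeasureTheory.MemLp.four_of_sq {X : Ω → ℝ} (hX : AEStronglyMeasurable X P)
    (h : MemLp (fun ω => X ω ^ 2) 2 P) : MemLp X 4 P := by
  have h4 : (4 : ENNReal) / 2 = 2 := by
    rw [← ENNReal.toReal_eq_toReal_iff' (ENNReal.div_ne_top (by simp) (by simp)) (by simp),
      ENNReal.toReal_div]
    norm_num
  rw [← memLp_norm_rpow_iff (q := 2) hX (by simp) (by simp), h4]
  simpa using h

lemma MeasureTheory.MemLp.mul_of_four {X Y : Ω → ℝ} (hX : MemLp X 4 P) (hY : MemLp Y 4 P) :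
    MemLp (fun ω => X ω * Y ω) 2 P := by
  have : ENNReal.HolderTriple 4 4 2 := ⟨by
    rw [← ENNReal.toReal_eq_toReal_iff' (by simp) (by simp),
      ENNReal.toReal_add (by simp) (by simp)]
    norm_num [ENNReal.toReal_inv]⟩
  exact MemLp.mul' hY hX

lemma MomentLE.half [IsProbabilityMeasure P] {X : Ω → ℝ} {k : ℕ} {C : ℝ}
    (h : MomentLE P X (2 * k) C) (hX : AEStronglyMeasurable X P) : MomentLE P X k (1 + C) := by
  have hle : ∀ x : ℝ, |x| ≤ 1 + x ^ 2 := fun x => abs_le.2 ⟨by nlinarith, by nlinarith⟩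
  have hint : Integrable (fun ω => 1 + X ω ^ (2 * k)) P := (integrable_const _).add h.1
  have hpow : ∀ ω, |X ω ^ k| ≤ 1 + X ω ^ (2 * k) := fun ω => by
    have := hle (X ω ^ k); rwa [← pow_mul, mul_comm k 2] at this
  have h1 : Integrable (fun ω => X ω ^ k) P :=
    hint.mono' (hX.pow k) (Eventually.of_forall hpow)
  refine ⟨h1, ?_⟩
  calc ∫ ω, X ω ^ k ∂P ≤ ∫ ω, (1 + X ω ^ (2 * k)) ∂P :=
        integral_mono h1 hint fun ω => (le_abs_self _).trans (hpow ω)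
    _ ≤ 1 + C := by
        rw [integral_add (integrable_const _) h.1]
        simpa using h.2

lemma MomentLE.memLp_two {X : Ω → ℝ} {C : ℝ} (h : MomentLE P X 2 C)
    (hX : AEStronglyMeasurable X P) : MemLp X 2 P :=
  (memLp_two_iff_integrable_sq hX).2 h.1

lemma MomentLE.memLp_four {X : Ω → ℝ} {C : ℝ} (h : MomentLE P X 4 C)
    (hX : AEStronglyMeasurable X P) : MemLp X 4 P := by
  refine MemLp.four_of_sq hX ((memLp_two_iff_integrable_sq (hX.pow 2)).2 ?_)
  simpa [← pow_mul] using h.1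

lemma integral_add_add {X Y Z : Ω → ℝ} (hX : Integrable X P) (hY : Integrable Y P)
    (hZ : Integrable Z P) : ∫ ω, (X ω + Y ω + Z ω) ∂P =
      ∫ ω, X ω ∂P + ∫ ω, Y ω ∂P + ∫ ω, Z ω ∂P := by
  have hXY : Integrable (fun ω => X ω + Y ω) P := hX.add hY
  rw [integral_add hXY hZ, integral_add hX hY]

/-- Orthogonality of martingale differences. -/
lemma integral_sq_sum_martingaleDiff [IsFiniteMeasure P] (ℱ : Filtration ℕ mΩ) {X : ℕ → Ω → ℝ}
    (hmeas : ∀ t, StronglyMeasurable[ℱ (t + 1)] (X t)) (hX : ∀ t, MemLp (X t) 2 P)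
    (hcond : ∀ t, P[X t | ℱ t] =ᵐ[P] 0) (T : ℕ) :
    ∫ ω, (∑ t ∈ Finset.range T, X t ω) ^ 2 ∂P = ∑ t ∈ Finset.range T, ∫ ω, X t ω ^ 2 ∂P := by
  induction T with
  | zero => simp
  | succ T ih =>
    have hS : MemLp (fun ω => ∑ t ∈ Finset.range T, X t ω) 2 P :=
      memLp_finsetSum _ fun t _ => hX t
    have hSm : StronglyMeasurable[ℱ T] (fun ω => ∑ t ∈ Finset.range T, X t ω) :=
      Finset.stronglyMeasurable_fun_sum _ fun t ht =>
        (hmeas t).mono (ℱ.mono (Finset.mem_range.1 ht))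
    have hmul : Integrable ((fun ω => ∑ t ∈ Finset.range T, X t ω) * X T) P :=
      hS.integrable_mul (hX T)
    -- The partial sum is known at time `T`, so it can be pulled out of the conditional expectation
    -- of `X T`, which vanishes.
    have hcross : ∫ ω, (∑ t ∈ Finset.range T, X t ω) * X T ω ∂P = 0 := by
      have h1 := condExp_mul_of_stronglyMeasurable_left hSm hmul ((hX T).integrable one_le_two)
      have h2 := integral_condExp (μ := P) (ℱ.le T)
        (f := (fun ω => ∑ t ∈ Finset.range T, X t ω) * X T)
      have h3 : P[(fun ω => ∑ t ∈ Finset.range T, X t ω) * X T | ℱ T] =ᵐ[P] 0 := by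
        filter_upwards [h1, hcond T] with ω h h'
        rw [h, Pi.mul_apply, h']; simp
      rw [integral_congr_ae h3] at h2
      simpa using h2.symm
    simp only [Finset.sum_range_succ]
    have hexp : ∀ ω, (∑ t ∈ Finset.range T, X t ω + X T ω) ^ 2 =
        (∑ t ∈ Finset.range T, X t ω) ^ 2 + 2 * ((∑ t ∈ Finset.range T, X t ω) * X T ω) +
          X T ω ^ 2 := fun ω => by ring
    simp only [hexp]
    have hmul2 : Integrable (fun ω => 2 * ((∑ t ∈ Finset.range T, X t ω) * X T ω)) P :=
      hmul.const_mul 2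
    rw [integral_add_add hS.integrable_sq hmul2 (hX T).integrable_sq, integral_const_mul, hcross,
      ih]
    simp

/-- The conditional expectation is a contraction of the centered second moment. -/
lemma integral_sq_sub_condExp_le [IsFiniteMeasure P] {m : MeasurableSpace Ω} (hm : m ≤ mΩ)
    {X G : Ω → ℝ} (hX : MemLp X 2 P) (hG : P[X | m] =ᵐ[P] G) :
    ∫ ω, (X ω - G ω) ^ 2 ∂P ≤ ∫ ω, X ω ^ 2 ∂P := by
  have h1 := condVar_ae_le_condExp_sq hm hX
  have h2 : ∫ ω, (X ω - G ω) ^ 2 ∂P = ∫ ω, condVar m X P ω ∂P := by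
    rw [condVar, integral_condExp hm]
    refine integral_congr_ae ?_
    filter_upwards [hG] with ω h
    simp [h]
  rw [h2]
  refine (integral_mono_ae integrable_condVar integrable_condExp h1).trans_eq ?_
  rw [integral_condExp hm]
  rfl

/-- Orthogonality leaves `T` terms against a factor `T⁻¹ ^ 2`. The finite index serves both for
coordinates of vectors and for entries of matrices. -/
lemma integral_mean_sq_sum_martingaleDiff_le [IsFiniteMeasure P] {ι : Type*} (s : Finset ι)
    (ℱ : Filtration ℕ mΩ) {X : ι → ℕ → Ω → ℝ}
    (hmeas : ∀ i t, StronglyMeasurable[ℱ (t + 1)] (X i (t + 1)))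
    (hX : ∀ i t, MemLp (X i (t + 1)) 2 P) (hcond : ∀ i t, P[X i (t + 1) | ℱ t] =ᵐ[P] 0)
    {K : ℝ} (hK : ∀ t, ∑ i ∈ s, ∫ ω, X i (t + 1) ω ^ 2 ∂P ≤ K) {T : ℕ} (hT : 0 < T) :
    Integrable (fun ω => ∑ i ∈ s, ((T : ℝ)⁻¹ * ∑ t ∈ Finset.Icc 1 T, X i t ω) ^ 2) P ∧
    ∫ ω, ∑ i ∈ s, ((T : ℝ)⁻¹ * ∑ t ∈ Finset.Icc 1 T, X i t ω) ^ 2 ∂P ≤ K / T := by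
  have hsum : ∀ i ω, ∑ t ∈ Finset.Icc 1 T, X i t ω = ∑ t ∈ Finset.range T, X i (t + 1) ω := by
    intro i ω
    rw [Finset.range_eq_Ico, Finset.sum_Ico_add' (fun t => X i t ω) 0 T 1]
    rfl
  simp only [hsum, mul_pow]
  have hint : ∀ i, Integrable
      (fun ω => ((T : ℝ)⁻¹ ^ 2 * (∑ t ∈ Finset.range T, X i (t + 1) ω) ^ 2)) P := fun i =>
    (MemLp.integrable_sq (memLp_finsetSum _ fun t _ => hX i t)).const_mul _
  refine ⟨integrable_finsetSum _ fun i _ => hint i, ?_⟩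
  rw [integral_finsetSum _ fun i _ => hint i]
  simp only [integral_const_mul]
  have hmart : ∀ i, ∫ ω, (∑ t ∈ Finset.range T, X i (t + 1) ω) ^ 2 ∂P =
      ∑ t ∈ Finset.range T, ∫ ω, X i (t + 1) ω ^ 2 ∂P := fun i =>
    integral_sq_sum_martingaleDiff ℱ (X := fun t => X i (t + 1)) (hmeas i) (hX i) (hcond i) T
  simp only [hmart]
  rw [← Finset.mul_sum, Finset.sum_comm]
  have hT' : (0 : ℝ) < T := by exact_mod_cast hT
  calc _ ≤ (T : ℝ)⁻¹ ^ 2 * ∑ t ∈ Finset.range T, K := by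
        gcongr with t _; exact hK t
    _ = K / T := by simp; field_simp

/-- Markov's inequality. -/
lemma measure_lt_le_of_integral_le [IsFiniteMeasure P] {X : Ω → ℝ} (hX : Integrable X P)
    (h0 : ∀ ω, 0 ≤ X ω) {B δ : ℝ} (hB : 0 ≤ B) (h : ∫ ω, X ω ∂P ≤ δ * B) :
    P {ω | B < X ω} ≤ ENNReal.ofReal δ := by
  -- The level `0` cannot be divided out; it occurs below when `s = 0`. Then `X` vanishes almost
  -- everywhere.
  rcases hB.eq_or_lt with rfl | hB
  · have h1 : ∫ ω, X ω ∂P = 0 := le_antisymm (by simpa using h) (integral_nonneg h0)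
    rw [integral_eq_zero_iff_of_nonneg h0 hX] at h1
    have h2 : P {ω | 0 < X ω} = 0 := by
      refine measure_mono_null (fun ω hω => ?_) (ae_iff.1 h1)
      exact (ne_of_gt hω : X ω ≠ 0)
    rw [h2]; exact zero_le
  · have h1 := mul_meas_ge_le_integral_of_nonneg (Eventually.of_forall h0) hX B
    have h2 : P.real {ω | B ≤ X ω} ≤ δ := by
      have := h1.trans h
      rw [mul_comm δ] at this
      exact le_of_mul_le_mul_left this hB
    calc P {ω | B < X ω} ≤ P {ω | B ≤ X ω} := measure_mono fun ω (hω : B < X ω) => hω.le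
      _ = ENNReal.ofReal (P.real {ω | B ≤ X ω}) := (ofReal_measureReal).symm
      _ ≤ ENNReal.ofReal δ := ENNReal.ofReal_le_ofReal h2

/-- The Cauchy-Schwarz inequality for second moments. -/
lemma sq_integral_mul_le {X Y : Ω → ℝ} (hX : MemLp X 2 P) (hY : MemLp Y 2 P) :
    (∫ ω, X ω * Y ω ∂P) ^ 2 ≤ (∫ ω, X ω * X ω ∂P) * ∫ ω, Y ω * Y ω ∂P := by
  have hXX : Integrable (fun ω => X ω * X ω) P := hX.integrable_mul hX
  have hXY : Integrable (fun ω => X ω * Y ω) P := hX.integrable_mul hY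
  have hYY : Integrable (fun ω => Y ω * Y ω) P := hY.integrable_mul hY
  -- The quadratic is the second moment of `x * X + Y` as a function of `x`.
  have h := discrim_le_zero (a := ∫ ω, X ω * X ω ∂P) (b := 2 * ∫ ω, X ω * Y ω ∂P)
    (c := ∫ ω, Y ω * Y ω ∂P) fun x => by
      have h1 : 0 ≤ ∫ ω, (x * X ω + Y ω) ^ 2 ∂P := integral_nonneg fun _ => sq_nonneg _
      have h2 : ∀ ω, (x * X ω + Y ω) ^ 2 =
          x * x * (X ω * X ω) + 2 * x * (X ω * Y ω) + Y ω * Y ω := fun ω => by ring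
      simp only [h2] at h1
      rw [integral_add_add (hXX.const_mul _) (hXY.const_mul _) hYY, integral_const_mul,
        integral_const_mul] at h1
      linarith
  rw [discrim] at h
  linarith

end Moments

/-! ### From sparsity to spectral norm and trace. -/

section RowSums

variable {p : ℕ}

/-- Split `|x| = |x| ^ q * |x| ^ (1 - q)` and bound only the second factor. Applied to covariances,
with `hx` from Cauchy-Schwarz, it makes the sparsity sum dominate the absolute row sum. -/
lemma abs_le_absPow_mul {x a q : ℝ} (hq1 : q < 1) (hx : x ^ 2 ≤ a) :
    |x| ≤ absPow x q * a ^ ((1 - q) / 2) := by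
  by_cases h : x = 0
  · simp [absPow, h]
  · rw [absPow, if_neg h]
    have hpos : 0 < |x| := abs_pos.2 h
    calc |x| = |x| ^ q * |x| ^ (1 - q) := by
          rw [← Real.rpow_add hpos]; simp
      _ = |x| ^ q * (x ^ 2) ^ ((1 - q) / 2) := by
          congr 1
          rw [← sq_abs x, ← Real.rpow_natCast, ← Real.rpow_mul hpos.le]
          congr 1; push_cast; ring
      _ ≤ _ := by
          refine mul_le_mul_of_nonneg_left ?_ (Real.rpow_nonneg hpos.le _)
          exact Real.rpow_le_rpow (sq_nonneg _) hx (by linarith)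

/-- The Schur test for a symmetric matrix. -/
lemma sum_sq_mulVec_le_of_row_sum {S : Matrix (Fin p) (Fin p) ℝ} {s : ℝ}
    (hsymm : ∀ i j, S i j = S j i) (hs : ∀ i, ∑ j, |S i j| ≤ s) (x : Fin p → ℝ) :
    ∑ i, (S *ᵥ x) i ^ 2 ≤ s ^ 2 * ∑ i, x i ^ 2 := by
  have h1 : ∀ i, (S *ᵥ x) i ^ 2 ≤ s * ∑ j, |S i j| * x j ^ 2 := by
    intro i
    have h2 : |(S *ᵥ x) i| ≤ ∑ j, |S i j| * |x j| := by
      simp only [← abs_mul]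
      exact Finset.abs_sum_le_sum_abs (fun j => S i j * x j) Finset.univ
    calc (S *ᵥ x) i ^ 2 = |(S *ᵥ x) i| ^ 2 := (sq_abs _).symm
      _ ≤ (∑ j, |S i j| * |x j|) ^ 2 := pow_le_pow_left₀ (abs_nonneg _) h2 2
      -- Splitting the weight evenly before Cauchy-Schwarz leaves one row sum here; the column sums
      -- are row sums by symmetry.
      _ = (∑ j, √|S i j| * (√|S i j| * |x j|)) ^ 2 := by
          simp only [← mul_assoc, Real.mul_self_sqrt (abs_nonneg _)]
      _ ≤ (∑ j, √|S i j| ^ 2) * ∑ j, (√|S i j| * |x j|) ^ 2 :=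
          Finset.sum_mul_sq_le_sq_mul_sq _ _ _
      _ = (∑ j, |S i j|) * ∑ j, |S i j| * x j ^ 2 := by
          simp only [mul_pow, Real.sq_sqrt (abs_nonneg _), sq_abs]
      _ ≤ s * ∑ j, |S i j| * x j ^ 2 :=
          mul_le_mul_of_nonneg_right (hs i)
            (Finset.sum_nonneg fun j _ => mul_nonneg (abs_nonneg _) (sq_nonneg _))
  calc ∑ i, (S *ᵥ x) i ^ 2 ≤ ∑ i, s * ∑ j, |S i j| * x j ^ 2 := Finset.sum_le_sum fun i _ => h1 i
    _ = s * ∑ j, (∑ i, |S j i|) * x j ^ 2 := by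
        rw [← Finset.mul_sum, Finset.sum_comm]
        simp only [Finset.sum_mul, hsymm]
    _ ≤ s * ∑ j, s * x j ^ 2 := by
        rcases Nat.eq_zero_or_pos p with rfl | hp
        · simp
        · have hs0 : 0 ≤ s := (Finset.sum_nonneg fun j _ => abs_nonneg _).trans (hs ⟨0, hp⟩)
          gcongr with j _
          exact hs j
    _ = s ^ 2 * ∑ i, x i ^ 2 := by rw [← Finset.mul_sum]; ring

lemma dotProduct_mulVec_le_of_row_sum {S : Matrix (Fin p) (Fin p) ℝ} {s : ℝ} (hs0 : 0 ≤ s)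
    (hsymm : ∀ i j, S i j = S j i) (hs : ∀ i, ∑ j, |S i j| ≤ s) (x : Fin p → ℝ) :
    ∑ i, x i * (S *ᵥ x) i ≤ s * ∑ i, x i ^ 2 := by
  refine abs_le_of_sq_le_sq' (b := s * ∑ i, x i ^ 2) ?_ (by positivity) |>.2
  calc _ ≤ (∑ i, x i ^ 2) * ∑ i, (S *ᵥ x) i ^ 2 := Finset.sum_mul_sq_le_sq_mul_sq _ _ _
    _ ≤ (∑ i, x i ^ 2) * (s ^ 2 * ∑ i, x i ^ 2) := by
        gcongr; exact sum_sq_mulVec_le_of_row_sum hsymm hs x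
    _ = _ := by ring

/-- Large variances force large covariances, so sparsity controls the trace. -/
lemma sum_diag_le_of_mul_diag_le {S : Matrix (Fin p) (Fin p) ℝ} {s D : ℝ} (hD : 0 ≤ D)
    (hp : 0 < p) (hdiag : ∀ i, 0 ≤ S i i) (hs : ∀ i, ∑ j, |S i j| ≤ s)
    (h : ∀ i j, S i i * S j j ≤ S i j ^ 2 + 2 * D) : ∑ j, S j j ≤ s + p * √(2 * D) := by
  have : Nonempty (Fin p) := ⟨⟨0, hp⟩⟩
  -- For the row `i` of largest variance, `S j j ^ 2 ≤ S i i * S j j`, so every variance is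
  -- controlled by an entry of this single row.
  obtain ⟨i, hi⟩ := Finite.exists_max fun i => S i i
  have h1 : ∀ j, S j j ≤ |S i j| + √(2 * D) := by
    intro j
    refine abs_le_of_sq_le_sq' ?_ (by positivity) |>.2
    have h2 := h i j
    have h3 : S j j ^ 2 ≤ S i i * S j j := by nlinarith [hi j, hdiag j]
    have h4 : 0 ≤ |S i j| * √(2 * D) := by positivity
    have h5 := Real.sq_sqrt (show 0 ≤ 2 * D by positivity)
    have h6 := sq_abs (S i j)
    nlinarith
  calc ∑ j, S j j ≤ ∑ j, (|S i j| + √(2 * D)) := Finset.sum_le_sum fun j _ => h1 j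
    _ ≤ s + p * √(2 * D) := by
        rw [Finset.sum_add_distrib]
        simpa using hs i

end RowSums

/-! ### The model: measurability and second moments. -/

namespace FactorModel

variable {r p : ℕ} {Ω : Type*} [mΩ : MeasurableSpace Ω] {P : Measure Ω}

/-- The returns minus their mean vector. -/
def centered (M : FactorModel r p Ω P) (t : ℕ) (ω : Ω) : Fin p → ℝ := M.V *ᵥ M.f t ω + M.u t ω

/-- The conditional covariance matrix of the returns. -/
def condCov (M : FactorModel r p Ω P) (t : ℕ) (ω : Ω) : Matrix (Fin p) (Fin p) ℝ :=
  M.V * Matrix.diagonal (M.h t ω) * M.Vᵀ + M.SigmaU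

/-- The deviation of the products of returns from their conditional expectation. -/
def noise (M : FactorModel r p Ω P) (t : ℕ) (ω : Ω) : Matrix (Fin p) (Fin p) ℝ :=
  Matrix.vecMulVec (M.centered t ω) (M.centered t ω) - M.condCov t ω

section Basic

variable (M : FactorModel r p Ω P)

lemma centered_apply (t : ℕ) (ω : Ω) (i : Fin p) :
    M.centered t ω i = ∑ k, M.V i k * M.f t ω k + M.u t ω i := rfl

lemma y_sub_mean (t : ℕ) (ω : Ω) : M.y (t + 1) ω - M.mean = M.centered (t + 1) ω := by
  rw [M.y_eq, centered]; abel

lemma condCov_apply (t : ℕ) (ω : Ω) (i j : Fin p) :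
    M.condCov t ω i j = ∑ k, M.V i k * M.V j k * M.h t ω k + M.SigmaU i j := by
  simp only [condCov, Matrix.add_apply, Matrix.mul_apply (N := M.Vᵀ), Matrix.mul_diagonal,
    Matrix.transpose_apply]
  congr 1
  exact Finset.sum_congr rfl fun k _ => by ring

lemma noise_apply (t : ℕ) (ω : Ω) (i j : Fin p) :
    M.noise t ω i j = M.centered t ω i * M.centered t ω j - M.condCov t ω i j := rfl

lemma f_stronglyMeasurable (t : ℕ) (k : Fin r) :
    StronglyMeasurable[M.info (t + 1)] fun ω => M.f (t + 1) ω k :=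
  ((measurable_pi_apply k).comp (M.f_meas t)).stronglyMeasurable

lemma u_stronglyMeasurable (t : ℕ) (i : Fin p) :
    StronglyMeasurable[M.info (t + 1)] fun ω => M.u (t + 1) ω i :=
  ((measurable_pi_apply i).comp (M.u_meas t)).stronglyMeasurable

/-- The GARCH recursion propagates predictability from time `0`; it makes `noise` adapted. -/
lemma h_measurable (t : ℕ) : Measurable[M.info t] (M.h (t + 1)) := by
  induction t with
  | zero => exact M.h_meas
  | succ t ih =>
    have h1 : M.h (t + 2) = fun ω => M.omega + M.A *ᵥ (fun k => M.f (t + 1) ω k ^ 2) +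
        M.B *ᵥ M.h (t + 1) ω := funext fun ω => M.h_eq t ω
    have h2 : Measurable[M.info (t + 1)] (M.h (t + 1)) := ih.mono (M.info.mono t.le_succ) le_rfl
    change Measurable[M.info (t + 1)] (M.h (t + 2))
    rw [h1]
    have hf : ∀ k, Measurable[M.info (t + 1)] fun ω => M.f (t + 1) ω k := fun k =>
      (M.f_stronglyMeasurable t k).measurable
    have hh : ∀ k, Measurable[M.info (t + 1)] fun ω => M.h (t + 1) ω k := fun k =>
      (measurable_pi_apply k).comp h2
    refine @measurable_pi_lambda _ _ _ (M.info (t + 1)) _ _ fun k => ?_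
    have hA : Measurable[M.info (t + 1)] fun ω => ∑ l, M.A k l * M.f (t + 1) ω l ^ 2 :=
      Finset.measurable_fun_sum _ fun l _ => ((hf l).pow_const 2).const_mul _
    have hB : Measurable[M.info (t + 1)] fun ω => ∑ l, M.B k l * M.h (t + 1) ω l :=
      Finset.measurable_fun_sum _ fun l _ => (hh l).const_mul _
    exact (hA.const_add _).add hB

lemma h_stronglyMeasurable (t : ℕ) (k : Fin r) :
    StronglyMeasurable[M.info t] fun ω => M.h (t + 1) ω k :=
  ((measurable_pi_apply k).comp (M.h_measurable t)).stronglyMeasurable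

lemma f_aestronglyMeasurable (t : ℕ) (k : Fin r) :
    AEStronglyMeasurable (fun ω => M.f (t + 1) ω k) P :=
  ((M.f_stronglyMeasurable t k).mono (M.info.le _)).aestronglyMeasurable

lemma u_aestronglyMeasurable (t : ℕ) (i : Fin p) :
    AEStronglyMeasurable (fun ω => M.u (t + 1) ω i) P :=
  ((M.u_stronglyMeasurable t i).mono (M.info.le _)).aestronglyMeasurable

lemma h_aestronglyMeasurable (t : ℕ) (k : Fin r) :
    AEStronglyMeasurable (fun ω => M.h (t + 1) ω k) P :=
  ((M.h_stronglyMeasurable t k).mono (M.info.le _)).aestronglyMeasurable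

lemma centered_stronglyMeasurable (t : ℕ) (i : Fin p) :
    StronglyMeasurable[M.info (t + 1)] fun ω => M.centered (t + 1) ω i := by
  simp only [centered_apply]
  exact (Finset.stronglyMeasurable_fun_sum _ fun k _ =>
    (M.f_stronglyMeasurable t k).const_mul _).add (M.u_stronglyMeasurable t i)

lemma noise_stronglyMeasurable (t : ℕ) (i j : Fin p) :
    StronglyMeasurable[M.info (t + 1)] fun ω => M.noise (t + 1) ω i j := by
  simp only [noise_apply, condCov_apply]
  refine ((M.centered_stronglyMeasurable t i).mul (M.centered_stronglyMeasurable t j)).sub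
    (StronglyMeasurable.add (Finset.stronglyMeasurable_fun_sum _ fun k _ => ?_)
      stronglyMeasurable_const)
  exact ((M.h_stronglyMeasurable t k).mono (M.info.mono t.le_succ)).const_mul _

lemma sum_sq_V (k : Fin r) : ∑ i, M.V i k ^ 2 = p := by
  have := congrFun (congrFun M.V_norm k) k
  simpa [Matrix.mul_apply, sq] using this

lemma sum_sq_V_mulVec (x : Fin r → ℝ) :
    ∑ i, (M.V *ᵥ x) i ^ 2 = p * ∑ k, x k ^ 2 := by
  have h1 : ∑ i, (M.V *ᵥ x) i ^ 2 = (M.V *ᵥ x) ⬝ᵥ (M.V *ᵥ x) := by simp [dotProduct, sq]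
  rw [h1, Matrix.dotProduct_mulVec, Matrix.vecMul_mulVec, M.V_norm]
  simp [dotProduct, Matrix.vecMul_smul, Finset.mul_sum, sq, mul_assoc]

lemma sum_sq_centered_le (t : ℕ) (ω : Ω) :
    ∑ i, M.centered t ω i ^ 2 ≤ 2 * (p * ∑ k, M.f t ω k ^ 2) + 2 * ∑ i, M.u t ω i ^ 2 := by
  rw [← M.sum_sq_V_mulVec, Finset.mul_sum, Finset.mul_sum, ← Finset.sum_add_distrib]
  refine Finset.sum_le_sum fun i _ => ?_
  rw [centered, Pi.add_apply]
  nlinarith [sq_nonneg ((M.V *ᵥ M.f t ω) i - M.u t ω i)]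

lemma centered_mul_condExp (t : ℕ) (i j : Fin p) :
    P[fun ω => M.centered (t + 1) ω i * M.centered (t + 1) ω j | M.info t] =ᵐ[P]
      fun ω => M.condCov (t + 1) ω i j := by
  have h := M.y_condCov t i j
  simp only [← Pi.sub_apply, y_sub_mean] at h
  exact h

lemma centered_memLp_two (t : ℕ) (i : Fin p) :
    MemLp (fun ω => M.centered (t + 1) ω i) 2 P := by
  simp only [centered_apply]
  exact MemLp.add (memLp_finsetSum _ fun k _ => (M.f_memLp t k).const_mul _) (M.u_memLp t i)

variable [IsProbabilityMeasure P]

lemma centered_condExp (t : ℕ) (i : Fin p) :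
    P[fun ω => M.centered (t + 1) ω i | M.info t] =ᵐ[P] 0 := by
  have hf : ∀ k, Integrable (M.V i k • fun ω => M.f (t + 1) ω k) P := fun k =>
    ((M.f_memLp t k).integrable one_le_two).smul _
  have h0 : (fun ω => M.centered (t + 1) ω i) =
      ∑ k, (M.V i k • fun ω => M.f (t + 1) ω k) + fun ω => M.u (t + 1) ω i := by
    ext ω; simp [centered_apply]
  rw [h0]
  have h1 := condExp_add (integrable_finsetSum' Finset.univ fun k _ => hf k)
    ((M.u_memLp t i).integrable one_le_two) (M.info t)
  have h2 := condExp_finsetSum (s := Finset.univ) (fun k _ => hf k) (M.info t)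
  have h3 : ∀ᵐ ω ∂P, ∀ k, (P[M.V i k • fun ω => M.f (t + 1) ω k | M.info t]) ω = 0 := by
    rw [ae_all_iff]
    intro k
    filter_upwards [condExp_smul (μ := P) (M.V i k) (fun ω => M.f (t + 1) ω k) (M.info t),
      M.f_condMean t k] with ω h h'
    rw [h, Pi.smul_apply, h']; simp
  filter_upwards [h1, h2, h3, M.u_condMean t i] with ω h1 h2 h3 h4
  rw [h1, Pi.add_apply, h2, h4, Finset.sum_apply]
  simp [h3]

lemma integral_f_mul_u (t : ℕ) (k : Fin r) (i : Fin p) :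
    Integrable (fun ω => M.f (t + 1) ω k * M.u (t + 1) ω i) P ∧
      ∫ ω, M.f (t + 1) ω k * M.u (t + 1) ω i ∂P = 0 := by
  refine ⟨(M.f_memLp t k).integrable_mul (M.u_memLp t i), ?_⟩
  have h1 : IndepFun (fun ω => M.f (t + 1) ω k) (fun ω => M.u (t + 1) ω i) P :=
    (M.indep t).comp (measurable_pi_apply k) (measurable_pi_apply i)
  have h2 := h1.integral_mul_eq_mul_integral (M.f_aestronglyMeasurable t k)
    (M.u_aestronglyMeasurable t i)
  have h3 : ∫ ω, M.f (t + 1) ω k ∂P = 0 := by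
    rw [← integral_condExp (M.info.le t), integral_congr_ae (M.f_condMean t k)]
    simp
  rw [h3, zero_mul] at h2
  exact h2

lemma integral_f_mul_f (t : ℕ) (k l : Fin r) :
    ∫ ω, M.f (t + 1) ω k * M.f (t + 1) ω l ∂P =
      if k = l then ∫ ω, M.h (t + 1) ω k ∂P else 0 := by
  rw [← integral_condExp (M.info.le t), integral_congr_ae (M.f_condCov t k l)]
  split_ifs with h
  · subst h; simp
  · simp [Matrix.diagonal_apply_ne _ h]

/-- `SigmaU` is the unconditional covariance matrix of the idiosyncratic component. -/
lemma integral_u_mul_u (hh : ∀ t k, Integrable (fun ω => M.h (t + 1) ω k) P) (t : ℕ)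
    (i j : Fin p) : ∫ ω, M.u (t + 1) ω i * M.u (t + 1) ω j ∂P = M.SigmaU i j := by
  have hff : ∀ k l, Integrable (fun ω => M.V i k * M.V j l *
      (M.f (t + 1) ω k * M.f (t + 1) ω l)) P := fun k l =>
    ((M.f_memLp t k).integrable_mul (M.f_memLp t l)).const_mul _
  have hfu : ∀ i j k, Integrable (fun ω => M.V i k * (M.f (t + 1) ω k * M.u (t + 1) ω j)) P :=
    fun i j k => (M.integral_f_mul_u t k j).1.const_mul _
  have huu : Integrable (fun ω => M.u (t + 1) ω i * M.u (t + 1) ω j) P :=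
    (M.u_memLp t i).integrable_mul (M.u_memLp t j)
  -- The second moment of the returns is computed twice: here by conditioning, below by expansion,
  -- where independence and `E f = 0` remove the cross terms. Comparing the two isolates `SigmaU`.
  have h1 : ∫ ω, M.centered (t + 1) ω i * M.centered (t + 1) ω j ∂P =
      ∑ k, M.V i k * M.V j k * ∫ ω, M.h (t + 1) ω k ∂P + M.SigmaU i j := by
    rw [← integral_condExp (M.info.le t), integral_congr_ae (M.centered_mul_condExp t i j)]
    simp only [condCov_apply]
    rw [integral_add (integrable_finsetSum _ fun k _ => (hh t k).const_mul _)
      (integrable_const _), integral_finsetSum _ fun k _ => (hh t k).const_mul _]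
    simp [integral_const_mul]
  have h2 : ∀ ω, M.centered (t + 1) ω i * M.centered (t + 1) ω j =
      ∑ k, ∑ l, M.V i k * M.V j l * (M.f (t + 1) ω k * M.f (t + 1) ω l) +
      (∑ k, M.V i k * (M.f (t + 1) ω k * M.u (t + 1) ω j) +
        ∑ k, M.V j k * (M.f (t + 1) ω k * M.u (t + 1) ω i)) +
      M.u (t + 1) ω i * M.u (t + 1) ω j := by
    intro ω
    have h3 : ∑ k, ∑ l, M.V i k * M.V j l * (M.f (t + 1) ω k * M.f (t + 1) ω l) =
        (∑ k, M.V i k * M.f (t + 1) ω k) * ∑ l, M.V j l * M.f (t + 1) ω l := by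
      rw [Finset.sum_mul_sum]
      exact Finset.sum_congr rfl fun k _ => Finset.sum_congr rfl fun l _ => by ring
    have h4 : ∀ i j, ∑ k, M.V i k * (M.f (t + 1) ω k * M.u (t + 1) ω j) =
        (∑ k, M.V i k * M.f (t + 1) ω k) * M.u (t + 1) ω j := by
      intro i j
      rw [Finset.sum_mul]
      exact Finset.sum_congr rfl fun k _ => by ring
    rw [h3, h4, h4, centered_apply, centered_apply]
    ring
  have hfu2 : Integrable (fun ω => ∑ k, M.V i k * (M.f (t + 1) ω k * M.u (t + 1) ω j) +
      ∑ k, M.V j k * (M.f (t + 1) ω k * M.u (t + 1) ω i)) P :=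
    (integrable_finsetSum _ fun k _ => hfu i j k).add (integrable_finsetSum _ fun k _ => hfu j i k)
  simp only [h2] at h1
  rw [integral_add_add (integrable_finsetSum _ fun k _ => integrable_finsetSum _ fun l _ => hff k l)
    hfu2 huu,
    integral_add (integrable_finsetSum _ fun k _ => hfu i j k)
      (integrable_finsetSum _ fun k _ => hfu j i k),
    integral_finsetSum _ fun k _ => hfu i j k, integral_finsetSum _ fun k _ => hfu j i k,
    integral_finsetSum _ fun k _ => integrable_finsetSum _ fun l _ => hff k l] at h1
  have h4 : ∀ k, ∫ ω, ∑ l, M.V i k * M.V j l * (M.f (t + 1) ω k * M.f (t + 1) ω l) ∂P =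
      M.V i k * M.V j k * ∫ ω, M.h (t + 1) ω k ∂P := by
    intro k
    rw [integral_finsetSum _ fun l _ => hff k l]
    simp [integral_const_mul, integral_f_mul_f]
  simp only [h4, integral_const_mul, (M.integral_f_mul_u t _ _).2, mul_zero,
    Finset.sum_const_zero, add_zero] at h1
  linarith

end Basic

/-! ### Moment bounds in terms of `p`, `s` and the trace. -/

section Bounds

variable [IsProbabilityMeasure P] {M : FactorModel r p Ω P} {C : ℝ}

lemma Moments.f_four (hM : M.Moments C) (t : ℕ) (k : Fin r) :
    MomentLE P (fun ω => M.f (t + 1) ω k) 4 (1 + C) :=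
  MomentLE.half (k := 4) (hM.1 t k) (M.f_aestronglyMeasurable t k)

lemma Moments.f_two (hM : M.Moments C) (t : ℕ) (k : Fin r) :
    MomentLE P (fun ω => M.f (t + 1) ω k) 2 (1 + (1 + C)) :=
  MomentLE.half (k := 2) (hM.f_four t k) (M.f_aestronglyMeasurable t k)

lemma Moments.f_memLp_four (hM : M.Moments C) (t : ℕ) (k : Fin r) :
    MemLp (fun ω => M.f (t + 1) ω k) 4 P :=
  (hM.f_four t k).memLp_four (M.f_aestronglyMeasurable t k)

lemma Moments.h_integrable (hM : M.Moments C) (t : ℕ) (k : Fin r) :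
    Integrable (fun ω => M.h (t + 1) ω k) P :=
  (MomentLE.memLp_two (MomentLE.half (k := 2) (hM.2.1 t k) (M.h_aestronglyMeasurable t k))
    (M.h_aestronglyMeasurable t k)).integrable one_le_two

lemma Moments.integral_u_mul_u (hM : M.Moments C) (t : ℕ) (i j : Fin p) :
    ∫ ω, M.u (t + 1) ω i * M.u (t + 1) ω j ∂P = M.SigmaU i j :=
  M.integral_u_mul_u (fun t k => hM.h_integrable t k) t i j

lemma Moments.uu_two (hM : M.Moments C) (t : ℕ) (i j : Fin p) :
    MomentLE P (fun ω => M.u (t + 1) ω i * M.u (t + 1) ω j - M.SigmaU i j) 2 (1 + C) :=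
  MomentLE.half (k := 2) (hM.2.2.1 t i j)
    (((M.u_aestronglyMeasurable t i).mul (M.u_aestronglyMeasurable t j)).sub
      aestronglyMeasurable_const)

lemma Moments.uu_memLp_two (hM : M.Moments C) (t : ℕ) (i j : Fin p) :
    MemLp (fun ω => M.u (t + 1) ω i * M.u (t + 1) ω j) 2 P := by
  have h := (hM.uu_two t i j).memLp_two (((M.u_aestronglyMeasurable t i).mul
    (M.u_aestronglyMeasurable t j)).sub aestronglyMeasurable_const)
  have h2 : MemLp (fun _ : Ω => M.SigmaU i j) 2 P := memLp_const _
  have h3 := h.add h2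
  simpa [Pi.add_def] using h3

lemma Moments.u_memLp_four (hM : M.Moments C) (t : ℕ) (i : Fin p) :
    MemLp (fun ω => M.u (t + 1) ω i) 4 P :=
  MemLp.four_of_sq (M.u_aestronglyMeasurable t i) (by simpa [sq] using hM.uu_memLp_two t i i)

lemma Moments.SigmaU_symm (hM : M.Moments C) (i j : Fin p) : M.SigmaU i j = M.SigmaU j i := by
  rw [← hM.integral_u_mul_u 0, ← hM.integral_u_mul_u 0]
  simp only [mul_comm]

lemma Moments.SigmaU_diag_nonneg (hM : M.Moments C) (i : Fin p) : 0 ≤ M.SigmaU i i := by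
  rw [← hM.integral_u_mul_u 0]
  exact integral_nonneg fun _ => mul_self_nonneg _

lemma Moments.SigmaU_sq_le (hM : M.Moments C) (i j : Fin p) :
    M.SigmaU i j ^ 2 ≤ M.SigmaU i i * M.SigmaU j j := by
  simp only [← hM.integral_u_mul_u 0]
  exact sq_integral_mul_le (M.u_memLp 0 i) (M.u_memLp 0 j)

lemma Moments.row_sum_le (hM : M.Moments C) {q s : ℝ} (hq1 : q < 1) (hs : M.Sparse q s)
    (i : Fin p) : ∑ j, |M.SigmaU i j| ≤ s :=
  (Finset.sum_le_sum fun j _ => abs_le_absPow_mul hq1 (hM.SigmaU_sq_le i j)).trans (hs i)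

lemma Moments.integral_sq_uu (hM : M.Moments C) (t : ℕ) (i j : Fin p) :
    ∫ ω, (M.u (t + 1) ω i * M.u (t + 1) ω j) ^ 2 ∂P ≤ (1 + C) + M.SigmaU i j ^ 2 := by
  have h1 := (hM.uu_two t i j).2
  have h2 : ∀ ω, (M.u (t + 1) ω i * M.u (t + 1) ω j) ^ 2 =
      (M.u (t + 1) ω i * M.u (t + 1) ω j - M.SigmaU i j) ^ 2 +
      2 * M.SigmaU i j * (M.u (t + 1) ω i * M.u (t + 1) ω j) + -M.SigmaU i j ^ 2 :=
    fun ω => by ring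
  simp only [h2]
  rw [integral_add_add (hM.uu_two t i j).1
    (((hM.uu_memLp_two t i j).integrable one_le_two).const_mul _) (integrable_const _),
    integral_const_mul, hM.integral_u_mul_u]
  simp only [integral_const, probReal_univ, smul_eq_mul]
  linarith

/-- With `a`, `b` the centered squares of `u i`, `u j`, expand `(u i * u j) ^ 2` and use `a * b ≥
-(a ^ 2 + b ^ 2) / 2`: its mean is at least `SigmaU i i * SigmaU j j - (1 + C)`. By `integral_sq_uu`
it is at most `(1 + C) + SigmaU i j ^ 2`. -/
lemma Moments.diag_mul_diag_le (hM : M.Moments C) (i j : Fin p) :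
    M.SigmaU i i * M.SigmaU j j ≤ M.SigmaU i j ^ 2 + 2 * (1 + C) := by
  have h1 := hM.integral_sq_uu 0 i j
  have hi := hM.uu_two 0 i i
  have hj := hM.uu_two 0 j j
  have h2 : ∫ ω, (M.SigmaU j j * (M.u (0 + 1) ω i * M.u (0 + 1) ω i) +
      M.SigmaU i i * (M.u (0 + 1) ω j * M.u (0 + 1) ω j) + -(M.SigmaU i i * M.SigmaU j j)) ∂P ≤
      ∫ ω, ((M.u (0 + 1) ω i * M.u (0 + 1) ω j) ^ 2 +
        2⁻¹ * (M.u (0 + 1) ω i * M.u (0 + 1) ω i - M.SigmaU i i) ^ 2 +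
        2⁻¹ * (M.u (0 + 1) ω j * M.u (0 + 1) ω j - M.SigmaU j j) ^ 2) ∂P := by
    refine integral_mono ?_ ?_ fun ω => ?_
    · exact ((((hM.uu_memLp_two 0 i i).integrable one_le_two).const_mul _).add
        (((hM.uu_memLp_two 0 j j).integrable one_le_two).const_mul _)).add (integrable_const _)
    · exact ((hM.uu_memLp_two 0 i j).integrable_sq.add (hi.1.const_mul _)).add (hj.1.const_mul _)
    · have := sq_nonneg ((M.u (0 + 1) ω i * M.u (0 + 1) ω i - M.SigmaU i i) +
        (M.u (0 + 1) ω j * M.u (0 + 1) ω j - M.SigmaU j j))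
      dsimp only
      nlinarith
  rw [integral_add_add (((hM.uu_memLp_two 0 i i).integrable one_le_two).const_mul _)
    (((hM.uu_memLp_two 0 j j).integrable one_le_two).const_mul _) (integrable_const _),
    integral_add_add (hM.uu_memLp_two 0 i j).integrable_sq (hi.1.const_mul _) (hj.1.const_mul _),
    integral_const_mul, integral_const_mul, integral_const_mul, integral_const_mul,
    hM.integral_u_mul_u, hM.integral_u_mul_u] at h2
  simp only [integral_const, probReal_univ, smul_eq_mul] at h2
  have := hi.2
  have := hj.2
  linarith

lemma Moments.one_add_nonneg (hM : M.Moments C) (hp : 0 < p) : 0 ≤ 1 + C :=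
  (integral_nonneg fun _ => sq_nonneg _).trans (hM.uu_two 0 ⟨0, hp⟩ ⟨0, hp⟩).2

lemma Moments.trace_le (hM : M.Moments C) {q s b : ℝ} (hq1 : q < 1) (hs : M.Sparse q s)
    (hp : 0 < p) (hb : s ≤ b * p) : ∑ j, M.SigmaU j j ≤ (b + √(2 * (1 + C))) * p := by
  have := sum_diag_le_of_mul_diag_le (hM.one_add_nonneg hp) hp hM.SigmaU_diag_nonneg
    (hM.row_sum_le hq1 hs) hM.diag_mul_diag_le
  linarith

lemma Moments.integral_sum_sq_f (hM : M.Moments C) (t : ℕ) :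
    Integrable (fun ω => ∑ k, M.f (t + 1) ω k ^ 2) P ∧
      ∫ ω, ∑ k, M.f (t + 1) ω k ^ 2 ∂P ≤ r * (2 + C) := by
  have h : ∀ k, Integrable (fun ω => M.f (t + 1) ω k ^ 2) P := fun k => (hM.f_two t k).1
  refine ⟨integrable_finsetSum _ fun k _ => h k, ?_⟩
  rw [integral_finsetSum _ fun k _ => h k]
  calc _ ≤ ∑ _k : Fin r, (2 + C) := Finset.sum_le_sum fun k _ => by
        have := (hM.f_two t k).2; linarith
    _ = _ := by simp; ring

lemma Moments.integral_sum_sq_u (hM : M.Moments C) (t : ℕ) :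
    Integrable (fun ω => ∑ i, M.u (t + 1) ω i ^ 2) P ∧
      ∫ ω, ∑ i, M.u (t + 1) ω i ^ 2 ∂P = ∑ i, M.SigmaU i i := by
  refine ⟨integrable_finsetSum _ fun i _ => (M.u_memLp t i).integrable_sq, ?_⟩
  rw [integral_finsetSum _ fun i _ => (M.u_memLp t i).integrable_sq]
  exact Finset.sum_congr rfl fun i _ => by rw [← hM.integral_u_mul_u t]; simp only [sq]

/-- The variance of `u` along a loading column is the form of `SigmaU` there, at most `s` times the
squared length `p`. After division by `p ^ 2` this is the source of the rate `√(s / p)` for the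
factors. -/
lemma Moments.integral_sum_sq_Vu (hM : M.Moments C) {q s : ℝ} (hq1 : q < 1) (hs : M.Sparse q s)
    (hs0 : 0 ≤ s) (t : ℕ) :
    Integrable (fun ω => ∑ k, (∑ i, M.V i k * M.u (t + 1) ω i) ^ 2) P ∧
      ∫ ω, ∑ k, (∑ i, M.V i k * M.u (t + 1) ω i) ^ 2 ∂P ≤ r * (p * s) := by
  have h : ∀ k, Integrable (fun ω => (∑ i, M.V i k * M.u (t + 1) ω i) ^ 2) P := fun k =>
    MemLp.integrable_sq (memLp_finsetSum _ fun i _ => (M.u_memLp t i).const_mul _)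
  refine ⟨integrable_finsetSum _ fun k _ => h k, ?_⟩
  rw [integral_finsetSum _ fun k _ => h k]
  have h2 : ∀ k, ∫ ω, (∑ i, M.V i k * M.u (t + 1) ω i) ^ 2 ∂P ≤ p * s := by
    intro k
    have h3 : ∀ ω, (∑ i, M.V i k * M.u (t + 1) ω i) ^ 2 =
        ∑ i, ∑ j, M.V i k * M.V j k * (M.u (t + 1) ω i * M.u (t + 1) ω j) := by
      intro ω
      rw [sq, Finset.sum_mul_sum]
      exact Finset.sum_congr rfl fun i _ => Finset.sum_congr rfl fun j _ => by ring
    have h4 : ∀ i j, Integrable (fun ω => M.V i k * M.V j k *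
        (M.u (t + 1) ω i * M.u (t + 1) ω j)) P := fun i j =>
      ((M.u_memLp t i).integrable_mul (M.u_memLp t j)).const_mul _
    simp only [h3]
    rw [integral_finsetSum _ fun i _ => integrable_finsetSum _ fun j _ => h4 i j]
    have h5 : ∀ i, ∫ ω, ∑ j, M.V i k * M.V j k * (M.u (t + 1) ω i * M.u (t + 1) ω j) ∂P =
        M.V i k * (M.SigmaU *ᵥ fun j => M.V j k) i := by
      intro i
      rw [integral_finsetSum _ fun j _ => h4 i j]
      simp only [integral_const_mul, hM.integral_u_mul_u, Matrix.mulVec, dotProduct,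
        Finset.mul_sum]
      exact Finset.sum_congr rfl fun j _ => by ring
    simp only [h5]
    refine (dotProduct_mulVec_le_of_row_sum hs0 hM.SigmaU_symm (hM.row_sum_le hq1 hs)
      fun j => M.V j k).trans_eq ?_
    rw [M.sum_sq_V, mul_comm]
  calc _ ≤ ∑ _k : Fin r, p * s := Finset.sum_le_sum fun k _ => h2 k
    _ = _ := by simp

lemma Moments.integral_sq_sum_sq_f (hM : M.Moments C) (t : ℕ) :
    Integrable (fun ω => (∑ k, M.f (t + 1) ω k ^ 2) ^ 2) P ∧
      ∫ ω, (∑ k, M.f (t + 1) ω k ^ 2) ^ 2 ∂P ≤ r ^ 2 * (1 + C) := by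
  have hmem : MemLp (fun ω => ∑ k, M.f (t + 1) ω k ^ 2) 2 P := by
    simp only [sq]
    exact memLp_finsetSum _ fun k _ =>
      MemLp.mul_of_four (hM.f_memLp_four t k) (hM.f_memLp_four t k)
  refine ⟨hmem.integrable_sq, ?_⟩
  calc _ ≤ ∫ ω, r * ∑ k, M.f (t + 1) ω k ^ 4 ∂P := by
        refine integral_mono hmem.integrable_sq
          ((integrable_finsetSum _ fun k _ => (hM.f_four t k).1).const_mul _) fun ω => ?_
        have := sq_sum_le_card_mul_sum_sq (s := Finset.univ) (f := fun k => M.f (t + 1) ω k ^ 2)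
        simpa [← pow_mul] using this
    _ = r * ∑ k, ∫ ω, M.f (t + 1) ω k ^ 4 ∂P := by
        rw [integral_const_mul, integral_finsetSum _ fun k _ => (hM.f_four t k).1]
    _ ≤ r * ∑ _k : Fin r, (1 + C) := by
        gcongr with k _; exact (hM.f_four t k).2
    _ = _ := by simp; ring

lemma Moments.integral_sq_sum_sq_u (hM : M.Moments C) (t : ℕ) :
    Integrable (fun ω => (∑ i, M.u (t + 1) ω i ^ 2) ^ 2) P ∧
      ∫ ω, (∑ i, M.u (t + 1) ω i ^ 2) ^ 2 ∂P ≤ p ^ 2 * (1 + C) + (∑ i, M.SigmaU i i) ^ 2 := by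
  have h : ∀ ω, (∑ i, M.u (t + 1) ω i ^ 2) ^ 2 =
      ∑ i, ∑ j, (M.u (t + 1) ω i * M.u (t + 1) ω j) ^ 2 := by
    intro ω
    rw [sq, Finset.sum_mul_sum]
    simp only [mul_pow]
  have hint : ∀ i j, Integrable (fun ω => (M.u (t + 1) ω i * M.u (t + 1) ω j) ^ 2) P :=
    fun i j => (hM.uu_memLp_two t i j).integrable_sq
  simp only [h]
  refine ⟨integrable_finsetSum _ fun i _ => integrable_finsetSum _ fun j _ => hint i j, ?_⟩
  rw [integral_finsetSum _ fun i _ => integrable_finsetSum _ fun j _ => hint i j]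
  calc _ = ∑ i, ∑ j, ∫ ω, (M.u (t + 1) ω i * M.u (t + 1) ω j) ^ 2 ∂P :=
        Finset.sum_congr rfl fun i _ => integral_finsetSum _ fun j _ => hint i j
    _ ≤ ∑ i, ∑ j, ((1 + C) + M.SigmaU i i * M.SigmaU j j) := by
        refine Finset.sum_le_sum fun i _ => Finset.sum_le_sum fun j _ => ?_
        exact (hM.integral_sq_uu t i j).trans (by gcongr; exact hM.SigmaU_sq_le i j)
    _ = _ := by
        simp only [Finset.sum_add_distrib, ← Finset.sum_mul_sum]
        simp; ring

lemma Moments.integral_sum_sq_centered_le (hM : M.Moments C) {K : ℝ}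
    (hK : ∑ i, M.SigmaU i i ≤ K * p) (t : ℕ) :
    ∑ i, ∫ ω, M.centered (t + 1) ω i ^ 2 ∂P ≤ (2 * (r * (2 + C)) + 2 * K) * p := by
  have hint : ∀ i, Integrable (fun ω => M.centered (t + 1) ω i ^ 2) P := fun i =>
    (M.centered_memLp_two t i).integrable_sq
  have hf := hM.integral_sum_sq_f t
  have hu := hM.integral_sum_sq_u t
  rw [← integral_finsetSum _ fun i _ => hint i]
  calc _ ≤ ∫ ω, (2 * (p * ∑ k, M.f (t + 1) ω k ^ 2) + 2 * ∑ i, M.u (t + 1) ω i ^ 2) ∂P :=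
        integral_mono (integrable_finsetSum _ fun i _ => hint i)
          (((hf.1.const_mul _).const_mul _).add (hu.1.const_mul _)) (M.sum_sq_centered_le _)
    _ = 2 * (p * ∫ ω, ∑ k, M.f (t + 1) ω k ^ 2 ∂P) + 2 * ∑ i, M.SigmaU i i := by
        rw [integral_add ((hf.1.const_mul _).const_mul _) (hu.1.const_mul _), integral_const_mul,
          integral_const_mul, integral_const_mul, hu.2]
    _ ≤ 2 * (p * (r * (2 + C))) + 2 * (K * p) := by gcongr; exact hf.2
    _ = _ := by ring

lemma Moments.centered_memLp_four (hM : M.Moments C) (t : ℕ) (i : Fin p) :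
    MemLp (fun ω => M.centered (t + 1) ω i) 4 P := by
  simp only [centered_apply]
  exact MemLp.add (memLp_finsetSum _ fun k _ => (hM.f_memLp_four t k).const_mul _) (hM.u_memLp_four t i)

lemma Moments.centered_mul_memLp_two (hM : M.Moments C) (t : ℕ) (i j : Fin p) :
    MemLp (fun ω => M.centered (t + 1) ω i * M.centered (t + 1) ω j) 2 P :=
  MemLp.mul_of_four (hM.centered_memLp_four t i) (hM.centered_memLp_four t j)

lemma Moments.condCov_memLp_two (hM : M.Moments C) (t : ℕ) (i j : Fin p) :
    MemLp (fun ω => M.condCov (t + 1) ω i j) 2 P :=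
  ((hM.centered_mul_memLp_two t i j).condExp one_le_two).ae_eq (M.centered_mul_condExp t i j)

lemma Moments.noise_memLp_two (hM : M.Moments C) (t : ℕ) (i j : Fin p) :
    MemLp (fun ω => M.noise (t + 1) ω i j) 2 P :=
  (hM.centered_mul_memLp_two t i j).sub (hM.condCov_memLp_two t i j)

lemma Moments.noise_condExp (hM : M.Moments C) (t : ℕ) (i j : Fin p) :
    P[fun ω => M.noise (t + 1) ω i j | M.info t] =ᵐ[P] 0 := by
  have h1 := condExp_sub ((hM.centered_mul_memLp_two t i j).integrable one_le_two)
    ((hM.condCov_memLp_two t i j).integrable one_le_two) (M.info t)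
  have h2 : P[fun ω => M.condCov (t + 1) ω i j | M.info t] =ᵐ[P]
      P[fun ω => M.centered (t + 1) ω i * M.centered (t + 1) ω j | M.info t] :=
    (condExp_congr_ae (M.centered_mul_condExp t i j).symm).trans
      (condExp_condExp_of_le le_rfl (M.info.le t))
  refine h1.trans ?_
  filter_upwards [h2] with ω h
  simp [h]

/-- Conditional centering does not increase second moments, and the squared products sum to the
fourth power of the norm of the centered return. The constants `8` come from `(2 * x + 2 * y) ^ 2 ≤
8 * x ^ 2 + 8 * y ^ 2`. -/
lemma Moments.integral_sum_sq_noise_le (hM : M.Moments C) {K : ℝ}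
    (hK : ∑ i, M.SigmaU i i ≤ K * p) (t : ℕ) :
    ∑ ij : Fin p × Fin p, ∫ ω, M.noise (t + 1) ω ij.1 ij.2 ^ 2 ∂P ≤
      (8 * (r ^ 2 * (1 + C)) + 8 * ((1 + C) + K ^ 2)) * p ^ 2 := by
  have hint : ∀ ij : Fin p × Fin p, Integrable (fun ω =>
      (M.centered (t + 1) ω ij.1 * M.centered (t + 1) ω ij.2) ^ 2) P := fun ij =>
    (hM.centered_mul_memLp_two t ij.1 ij.2).integrable_sq
  have hf := hM.integral_sq_sum_sq_f t
  have hu := hM.integral_sq_sum_sq_u t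
  have htr : 0 ≤ ∑ i, M.SigmaU i i := Finset.sum_nonneg fun i _ => hM.SigmaU_diag_nonneg i
  have hexp : ∀ ω, ∑ ij : Fin p × Fin p,
      (M.centered (t + 1) ω ij.1 * M.centered (t + 1) ω ij.2) ^ 2 =
      (∑ i, M.centered (t + 1) ω i ^ 2) ^ 2 := by
    intro ω
    rw [sq (∑ i, _), Finset.sum_mul_sum, Fintype.sum_prod_type]
    simp only [mul_pow]
  calc _ ≤ ∑ ij : Fin p × Fin p, ∫ ω,
        (M.centered (t + 1) ω ij.1 * M.centered (t + 1) ω ij.2) ^ 2 ∂P :=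
        Finset.sum_le_sum fun ij _ => integral_sq_sub_condExp_le (M.info.le t)
          (hM.centered_mul_memLp_two t ij.1 ij.2) (M.centered_mul_condExp t ij.1 ij.2)
    _ = ∫ ω, ∑ ij : Fin p × Fin p,
        (M.centered (t + 1) ω ij.1 * M.centered (t + 1) ω ij.2) ^ 2 ∂P :=
        (integral_finsetSum _ fun ij _ => hint ij).symm
    _ ≤ ∫ ω, (8 * p ^ 2 * (∑ k, M.f (t + 1) ω k ^ 2) ^ 2 +
          8 * (∑ i, M.u (t + 1) ω i ^ 2) ^ 2) ∂P := by
        refine integral_mono (integrable_finsetSum _ fun ij _ => hint ij)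
          ((hf.1.const_mul _).add (hu.1.const_mul _)) fun ω => ?_
        dsimp only
        rw [hexp]
        have h1 := M.sum_sq_centered_le (t + 1) ω
        have h0 : 0 ≤ ∑ i, M.centered (t + 1) ω i ^ 2 := Finset.sum_nonneg fun _ _ => sq_nonneg _
        have h2 := pow_le_pow_left₀ h0 h1 2
        refine h2.trans ?_
        nlinarith [sq_nonneg ((p : ℝ) * (∑ k, M.f (t + 1) ω k ^ 2) - ∑ i, M.u (t + 1) ω i ^ 2)]
    _ = 8 * p ^ 2 * ∫ ω, (∑ k, M.f (t + 1) ω k ^ 2) ^ 2 ∂P +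
          8 * ∫ ω, (∑ i, M.u (t + 1) ω i ^ 2) ^ 2 ∂P := by
        rw [integral_add (hf.1.const_mul _) (hu.1.const_mul _), integral_const_mul,
          integral_const_mul]
    _ ≤ 8 * p ^ 2 * (r ^ 2 * (1 + C)) + 8 * (p ^ 2 * (1 + C) + (K * p) ^ 2) := by
        gcongr
        · exact hf.2
        · refine hu.2.trans ?_
          gcongr
    _ = _ := by ring

end Bounds

end FactorModel

/-! ### Decomposition of the sample covariance and of the factor error. -/

lemma norm_toEuclideanLin_le_of_sum_sq_le {p : ℕ} {A : Matrix (Fin p) (Fin p) ℝ} {a : ℝ}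
    (ha : 0 ≤ a) (x : EuclideanSpace ℝ (Fin p))
    (h : ∑ i, (A *ᵥ x.ofLp) i ^ 2 ≤ a ^ 2 * ∑ i, x i ^ 2) :
    ‖Matrix.toEuclideanLin A x‖ ≤ a * ‖x‖ := by
  refine abs_le_of_sq_le_sq' ?_ (by positivity) |>.2
  rw [mul_pow, EuclideanSpace.norm_sq_eq, EuclideanSpace.norm_sq_eq]
  simpa [Matrix.toLpLin_apply] using h

lemma IsPCALoading.sum_sq {r p : ℕ} {S : Matrix (Fin p) (Fin p) ℝ} {W : Matrix (Fin p) (Fin r) ℝ}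
    (hW : IsPCALoading S W) (k : Fin r) : ∑ i, W i k ^ 2 = p := by
  obtain ⟨hrp, lam, Q, -, hQ, -, hWQ⟩ := hW
  have h := congrFun (congrFun hQ (Fin.castLE hrp k)) (Fin.castLE hrp k)
  simp only [Matrix.mul_apply, Matrix.transpose_apply, Matrix.one_apply_eq] at h
  simp only [hWQ, mul_pow, Real.sq_sqrt (Nat.cast_nonneg p)]
  rw [← Finset.mul_sum]
  simp only [sq, h, mul_one]

namespace FactorModel

variable {r p : ℕ} {Ω : Type*} [mΩ : MeasurableSpace Ω] {P : Measure Ω}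

/-- The sample mean of the centered returns. -/
def centeredBar (M : FactorModel r p Ω P) (T : ℕ) (ω : Ω) (i : Fin p) : ℝ :=
  (T : ℝ)⁻¹ * ∑ t ∈ Finset.Icc 1 T, M.centered t ω i

/-- The sample mean of the noise matrices. -/
def noiseBar (M : FactorModel r p Ω P) (T : ℕ) (ω : Ω) : Matrix (Fin p) (Fin p) ℝ :=
  Matrix.of fun i j => (T : ℝ)⁻¹ * ∑ t ∈ Finset.Icc 1 T, M.noise t ω i j

/-- The mean conditional factor variances. -/
def hBar (M : FactorModel r p Ω P) (T : ℕ) (ω : Ω) (k : Fin r) : ℝ :=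
  (T : ℝ)⁻¹ * ∑ t ∈ Finset.Icc 1 T, M.h t ω k

section Decomposition

variable (M : FactorModel r p Ω P) {T : ℕ}

lemma SigmaFBar_eq_diagonal (T : ℕ) (ω : Ω) :
    M.SigmaFBar T ω = Matrix.diagonal (M.hBar T ω) := by
  ext k l
  rw [SigmaFBar, Matrix.smul_apply, Matrix.sum_apply, smul_eq_mul]
  rcases eq_or_ne k l with rfl | h
  · simp [hBar]
  · simp [Matrix.diagonal_apply_ne _ h]

lemma hBar_nonneg (ω : Ω) (k : Fin r) : 0 ≤ M.hBar T ω k := by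
  refine mul_nonneg (by positivity) (Finset.sum_nonneg fun t ht => ?_)
  obtain ⟨n, rfl⟩ := Nat.exists_eq_add_of_le' (Finset.mem_Icc.1 ht).1
  exact M.h_nonneg n ω k

lemma y_sub_yBar (hT : 0 < T) {t : ℕ} (ht : 1 ≤ t) (ω : Ω) (i : Fin p) :
    (M.y t ω - M.yBar T ω) i = M.centered t ω i - M.centeredBar T ω i := by
  have hT' : (T : ℝ) ≠ 0 := by exact_mod_cast hT.ne'
  have hy : ∀ t, 1 ≤ t → M.y t ω i = M.mean i + M.centered t ω i := by
    intro t ht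
    obtain ⟨n, rfl⟩ := Nat.exists_eq_add_of_le' ht
    have := congrFun (M.y_sub_mean n ω) i
    rw [Pi.sub_apply] at this
    linarith
  have hbar : M.yBar T ω i = M.mean i + M.centeredBar T ω i := by
    rw [yBar, Pi.smul_apply, Finset.sum_apply, smul_eq_mul,
      Finset.sum_congr rfl fun t ht => hy t (Finset.mem_Icc.1 ht).1, Finset.sum_add_distrib, mul_add,
      centeredBar]
    simp [hT']
  rw [Pi.sub_apply, hy t ht, hbar]
  ring

/-- The unknown mean cancels, and the conditional covariances average to the low-rank signal plus
`SigmaU`. -/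
lemma sampleCov_sub_eq (hT : 0 < T) (ω : Ω) :
    M.sampleCov T ω - M.V * Matrix.diagonal (M.hBar T ω) * M.Vᵀ =
      M.SigmaU + M.noiseBar T ω -
        Matrix.vecMulVec (M.centeredBar T ω) (M.centeredBar T ω) := by
  have hT' : (T : ℝ) ≠ 0 := by exact_mod_cast hT.ne'
  ext i j
  have h1 : M.sampleCov T ω i j = (T : ℝ)⁻¹ * ∑ t ∈ Finset.Icc 1 T,
      M.centered t ω i * M.centered t ω j - M.centeredBar T ω i * M.centeredBar T ω j := by
    have h2 : ∀ k, ∑ t ∈ Finset.Icc 1 T, M.centered t ω k = T * M.centeredBar T ω k := fun k => by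
      rw [centeredBar, mul_inv_cancel_left₀ hT']
    have h3 : ∑ t ∈ Finset.Icc 1 T, (M.y t ω - M.yBar T ω) i * (M.y t ω - M.yBar T ω) j =
        ∑ t ∈ Finset.Icc 1 T, (M.centered t ω i * M.centered t ω j -
          M.centered t ω i * M.centeredBar T ω j - M.centeredBar T ω i * M.centered t ω j +
          M.centeredBar T ω i * M.centeredBar T ω j) := by
      refine Finset.sum_congr rfl fun t ht => ?_
      rw [M.y_sub_yBar hT (Finset.mem_Icc.1 ht).1, M.y_sub_yBar hT (Finset.mem_Icc.1 ht).1]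
      ring
    rw [sampleCov, Matrix.smul_apply, Matrix.sum_apply, smul_eq_mul]
    simp only [Matrix.vecMulVec_apply]
    rw [h3]
    simp only [Finset.sum_add_distrib, Finset.sum_sub_distrib, ← Finset.sum_mul, ← Finset.mul_sum,
      h2, Finset.sum_const, Nat.card_Icc, Nat.add_sub_cancel, nsmul_eq_mul]
    field_simp
    ring
  have h4 : (M.V * Matrix.diagonal (M.hBar T ω) * M.Vᵀ) i j =
      (T : ℝ)⁻¹ * ∑ t ∈ Finset.Icc 1 T, ∑ k, M.V i k * M.V j k * M.h t ω k := by
    simp only [Matrix.mul_apply (N := M.Vᵀ), Matrix.mul_diagonal, Matrix.transpose_apply, hBar]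
    rw [Finset.sum_comm, Finset.mul_sum]
    refine Finset.sum_congr rfl fun k _ => ?_
    rw [← Finset.mul_sum]
    ring
  rw [Matrix.sub_apply, h1, h4, Matrix.sub_apply, Matrix.add_apply, Matrix.vecMulVec_apply,
    noiseBar, Matrix.of_apply]
  simp only [noise_apply, condCov_apply, Finset.sum_sub_distrib, Finset.sum_add_distrib,
    Finset.sum_const, Nat.card_Icc, Nat.add_sub_cancel, nsmul_eq_mul]
  field_simp
  ring

/-- One estimate per piece: Schur test for `SigmaU`, Frobenius norm for the noise, squared length
for the rank-one part. -/
lemma norm_remainder_le {s : ℝ} (hs0 : 0 ≤ s) (hT : 0 < T)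
    (hsymm : ∀ i j, M.SigmaU i j = M.SigmaU j i) (hs : ∀ i, ∑ j, |M.SigmaU i j| ≤ s) (ω : Ω)
    (x : EuclideanSpace ℝ (Fin p)) :
    ‖Matrix.toEuclideanLin (M.sampleCov T ω - M.V * Matrix.diagonal (M.hBar T ω) * M.Vᵀ) x‖ ≤
      (s + √(∑ ij : Fin p × Fin p, M.noiseBar T ω ij.1 ij.2 ^ 2) +
        ∑ i, M.centeredBar T ω i ^ 2) * ‖x‖ := by
  have h1 := norm_toEuclideanLin_le_of_sum_sq_le hs0 x
    (sum_sq_mulVec_le_of_row_sum hsymm hs x.ofLp)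
  have h2 := norm_toEuclideanLin_le_of_sum_sq_le (A := M.noiseBar T ω)
    (Real.sqrt_nonneg (∑ ij : Fin p × Fin p, M.noiseBar T ω ij.1 ij.2 ^ 2)) x (by
      rw [Real.sq_sqrt (by positivity), Fintype.sum_prod_type, Finset.sum_mul]
      exact Finset.sum_le_sum fun i _ =>
        Finset.sum_mul_sq_le_sq_mul_sq Finset.univ (fun j => M.noiseBar T ω i j) x.ofLp)
  have h3 := norm_toEuclideanLin_le_of_sum_sq_le
    (A := Matrix.vecMulVec (M.centeredBar T ω) (M.centeredBar T ω))
    (a := ∑ i, M.centeredBar T ω i ^ 2) (by positivity) x (by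
      have h4 : ∀ i, (Matrix.vecMulVec (M.centeredBar T ω) (M.centeredBar T ω) *ᵥ x.ofLp) i =
          M.centeredBar T ω i * ∑ j, M.centeredBar T ω j * x j := by
        intro i
        simp only [Matrix.mulVec, dotProduct, Matrix.vecMulVec_apply, Finset.mul_sum, mul_assoc]
      simp only [h4, mul_pow]
      rw [← Finset.sum_mul, sq (∑ i, M.centeredBar T ω i ^ 2), mul_assoc]
      gcongr
      exact Finset.sum_mul_sq_le_sq_mul_sq _ _ _)
  rw [M.sampleCov_sub_eq hT, map_sub, map_add, LinearMap.sub_apply, LinearMap.add_apply]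
  refine (norm_sub_le _ _).trans ?_
  linarith [norm_add_le (Matrix.toEuclideanLin M.SigmaU x)
    (Matrix.toEuclideanLin (M.noiseBar T ω) x)]

/-- The deterministic part of the bound for the estimated factors. -/
lemma sq_fHat_sub_le (hT : 0 < T) {t : ℕ} (ht : 1 ≤ t) (ω : Ω) {W : Matrix (Fin p) (Fin r) ℝ}
    (hp : 0 < p) {k : Fin r} (hW : ∑ i, W i k ^ 2 = p) (σ : ℤˣ) {η : ℝ}
    (hη : ∑ i, (W i k - ((σ : ℤ) : ℝ) * M.V i k) ^ 2 ≤ η) :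
    (p * (M.fHat T W t ω k - ((σ : ℤ) : ℝ) * M.f t ω k)) ^ 2 ≤
      4 * (η * (p * ∑ k, M.f t ω k ^ 2) + (∑ i, M.V i k * M.u t ω i) ^ 2 +
        η * ∑ i, M.u t ω i ^ 2 + p * ∑ i, M.centeredBar T ω i ^ 2) := by
  have hp' : (p : ℝ) ≠ 0 := by exact_mod_cast hp.ne'
  have hv2 : (((σ : ℤ) : ℝ)) ^ 2 = 1 := by
    rcases Int.units_eq_one_or σ with h | h <;> simp [h]
  set v : ℝ := ((σ : ℤ) : ℝ)
  have hVV : ∑ i, M.V i k * (M.V *ᵥ M.f t ω) i = p * M.f t ω k := by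
    have h1 : ∑ i, M.V i k * (M.V *ᵥ M.f t ω) i = (M.Vᵀ *ᵥ (M.V *ᵥ M.f t ω)) k := rfl
    rw [h1, Matrix.mulVec_mulVec, M.V_norm, Matrix.smul_mulVec, Matrix.one_mulVec]
    rfl
  have hfhat : p * M.fHat T W t ω k =
      ∑ i, W i k * (M.centered t ω i - M.centeredBar T ω i) := by
    rw [fHat, Pi.smul_apply, smul_eq_mul, mul_inv_cancel_left₀ hp']
    simp only [Matrix.mulVec, dotProduct, Matrix.transpose_apply, M.y_sub_yBar hT ht]
  -- The four errors: loading error on the common component, idiosyncratic part along the true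
  -- loadings, loading error on the idiosyncratic part, and estimated mean.
  have hdec : p * (M.fHat T W t ω k - v * M.f t ω k) =
      ∑ i, (W i k - v * M.V i k) * (M.V *ᵥ M.f t ω) i + v * ∑ i, M.V i k * M.u t ω i +
      ∑ i, (W i k - v * M.V i k) * M.u t ω i + -∑ i, W i k * M.centeredBar T ω i := by
    rw [mul_sub, hfhat, mul_left_comm, ← hVV, Finset.mul_sum, Finset.mul_sum, ← Finset.sum_sub_distrib,
      ← Finset.sum_add_distrib, ← Finset.sum_add_distrib, ← Finset.sum_neg_distrib,
      ← Finset.sum_add_distrib]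
    refine Finset.sum_congr rfl fun i _ => ?_
    rw [centered, Pi.add_apply]
    ring
  have h1 : (∑ i, (W i k - v * M.V i k) * (M.V *ᵥ M.f t ω) i) ^ 2 ≤
      η * (p * ∑ k, M.f t ω k ^ 2) := by
    refine (Finset.sum_mul_sq_le_sq_mul_sq _ _ _).trans ?_
    rw [M.sum_sq_V_mulVec]
    gcongr
  have h2 : (∑ i, (W i k - v * M.V i k) * M.u t ω i) ^ 2 ≤ η * ∑ i, M.u t ω i ^ 2 := by
    refine (Finset.sum_mul_sq_le_sq_mul_sq _ _ _).trans ?_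
    gcongr
  have h3 : (∑ i, W i k * M.centeredBar T ω i) ^ 2 ≤ p * ∑ i, M.centeredBar T ω i ^ 2 := by
    refine (Finset.sum_mul_sq_le_sq_mul_sq _ _ _).trans_eq ?_
    rw [hW]
  have hfour : ∀ a b c d : ℝ, (a + b + c + d) ^ 2 ≤ 4 * (a ^ 2 + b ^ 2 + c ^ 2 + d ^ 2) := by
    intro a b c d
    nlinarith [sq_nonneg (a - b), sq_nonneg (a - c), sq_nonneg (a - d), sq_nonneg (b - c),
      sq_nonneg (b - d), sq_nonneg (c - d)]
  rw [hdec]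
  refine (hfour _ _ _ _).trans ?_
  rw [mul_pow v, hv2, one_mul, neg_sq]
  gcongr

end Decomposition

/-! ### The exceptional event and the resulting rates. -/

/-- A common bound for the moments of the quantities entering the estimates. -/
def momentBound (r : ℕ) (C b : ℝ) : ℝ :=
  r * (2 + C) + (b + √(2 * (1 + C))) + r + (2 * (r * (2 + C)) + 2 * (b + √(2 * (1 + C)))) +
    (8 * (r ^ 2 * (1 + C)) + 8 * ((1 + C) + (b + √(2 * (1 + C))) ^ 2))

section Events

variable [IsProbabilityMeasure P] {M : FactorModel r p Ω P} {C : ℝ}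

lemma Moments.exists_event (hM : M.Moments C) {q s b : ℝ} (hq1 : q < 1) (hs : M.Sparse q s)
    (hs0 : 0 ≤ s) (hb0 : 0 ≤ b) (hb : s ≤ b * p) (hp : 0 < p) {T t : ℕ} (hT : 0 < T) (ht : 1 ≤ t)
    {δ : ℝ} (hδ : 0 < δ) :
    ∃ N : Set Ω, P N ≤ ENNReal.ofReal (5 * δ) ∧ ∀ ω ∉ N,
      ∑ k, M.f t ω k ^ 2 ≤ momentBound r C b / δ ∧
      ∑ i, M.u t ω i ^ 2 ≤ momentBound r C b / δ * p ∧
      ∑ k, (∑ i, M.V i k * M.u t ω i) ^ 2 ≤ momentBound r C b / δ * (p * s) ∧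
      ∑ i, M.centeredBar T ω i ^ 2 ≤ momentBound r C b / δ * (p / T) ∧
      ∑ ij : Fin p × Fin p, M.noiseBar T ω ij.1 ij.2 ^ 2 ≤
        momentBound r C b / δ * (p ^ 2 / T) := by
  obtain ⟨n, rfl⟩ := Nat.exists_eq_add_of_le' ht
  have htr := hM.trace_le hq1 hs hp hb
  have hC := hM.one_add_nonneg hp
  set K0 := b + √(2 * (1 + C)) with hK0
  have hK0' : 0 ≤ K0 := by positivity
  have h2C : 0 ≤ 2 + C := by linarith
  set c1 : ℝ := r * (2 + C) with hc1
  have hc1' : 0 ≤ c1 := by positivity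
  set c2 : ℝ := 8 * (r ^ 2 * (1 + C)) + 8 * ((1 + C) + K0 ^ 2) with hc2
  have hc2' : 0 ≤ c2 := by positivity
  have hr : (0 : ℝ) ≤ r := by positivity
  have hL : momentBound r C b = c1 + K0 + r + (2 * c1 + 2 * K0) + c2 := rfl
  set L := momentBound r C b
  have hL0 : 0 ≤ L := by rw [hL]; positivity
  -- `L` is a sum of nonnegative constants, one per quantity, so it dominates each `κ` and one
  -- threshold `L / δ` serves all five.
  have markov : ∀ {X : Ω → ℝ} {κ B : ℝ}, Integrable X P → (∀ ω, 0 ≤ X ω) → 0 ≤ B →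
      ∫ ω, X ω ∂P ≤ κ * B → κ ≤ L → P {ω | L / δ * B < X ω} ≤ ENNReal.ofReal δ := by
    intro X κ B hX hX0 hB hXB hκ
    refine measure_lt_le_of_integral_le hX hX0 (by positivity) (hXB.trans ?_)
    calc κ * B ≤ L * B := by gcongr
      _ = δ * (L / δ * B) := by field_simp
  have hf := hM.integral_sum_sq_f n
  have hu := hM.integral_sum_sq_u n
  have hv := hM.integral_sum_sq_Vu hq1 hs hs0 n
  have hz := integral_mean_sq_sum_martingaleDiff_le (P := P) Finset.univ M.info
    (X := fun i t ω => M.centered t ω i) (fun i t => M.centered_stronglyMeasurable t i)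
    (fun i t => M.centered_memLp_two t i) (fun i t => M.centered_condExp t i)
    (fun t => hM.integral_sum_sq_centered_le htr t) hT
  have hn := integral_mean_sq_sum_martingaleDiff_le (P := P) Finset.univ M.info
    (X := fun (ij : Fin p × Fin p) t ω => M.noise t ω ij.1 ij.2)
    (fun ij t => M.noise_stronglyMeasurable t ij.1 ij.2)
    (fun ij t => hM.noise_memLp_two t ij.1 ij.2) (fun ij t => hM.noise_condExp t ij.1 ij.2)
    (fun t => hM.integral_sum_sq_noise_le htr t) hT
  have m1 := markov (κ := c1) (B := 1) hf.1 (fun ω => by positivity) zero_le_one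
    (by rw [mul_one]; exact hf.2) (by linarith)
  have m2 := markov (κ := K0) (B := p) hu.1 (fun ω => by positivity) (by positivity)
    (by rw [hu.2]; exact htr) (by linarith)
  have m3 := markov (κ := r) (B := p * s) hv.1 (fun ω => by positivity) (by positivity)
    hv.2 (by linarith)
  have m4 := markov (κ := 2 * c1 + 2 * K0) (B := p / T) hz.1 (fun ω => by positivity)
    (by positivity) (hz.2.trans_eq (by ring)) (by linarith)
  have m5 := markov (κ := c2) (B := p ^ 2 / T) hn.1 (fun ω => by positivity)
    (by positivity) (hn.2.trans_eq (by ring)) (by linarith)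
  refine ⟨_, ((measure_union_le _ _).trans (add_le_add ((measure_union_le _ _).trans (add_le_add
    ((measure_union_le _ _).trans (add_le_add ((measure_union_le _ _).trans (add_le_add m1 m2)) m3))
    m4)) m5)).trans_eq ?_, fun ω hω => ?_⟩
  · have h5 : 5 * δ = δ + δ + δ + δ + δ := by ring
    rw [h5, ENNReal.ofReal_add (by positivity) hδ.le, ENNReal.ofReal_add (by positivity) hδ.le,
      ENNReal.ofReal_add (by positivity) hδ.le, ENNReal.ofReal_add hδ.le hδ.le]
  · simp only [Set.mem_union, Set.mem_ofPred_eq, not_or, not_lt] at hω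
    obtain ⟨⟨⟨⟨h1, h2⟩, h3⟩, h4⟩, h5⟩ := hω
    exact ⟨by simpa using h1, h2, h3, h4, h5⟩

end Events

end FactorModel

/-- The squared perturbation of the sample covariance matrix, relative to `p`. -/
lemma sq_remainder_le {s F m L p T : ℝ} (hp : 0 < p) (hT : 1 ≤ T) (hL : 0 ≤ L) (hF0 : 0 ≤ F)
    (hm0 : 0 ≤ m) (hF : F ≤ L * (p ^ 2 / T)) (hm : m ≤ L * (p / T)) :
    (s + √F + m) ^ 2 ≤ 3 * (1 + L + L ^ 2) * (p / T + s ^ 2 / p) * p := by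
  have hT0 : 0 < T := by linarith
  have h1 : (s + √F + m) ^ 2 ≤ 3 * (s ^ 2 + F + m ^ 2) := by
    have := Real.sq_sqrt hF0
    nlinarith [sq_nonneg (s - √F), sq_nonneg (s - m), sq_nonneg (√F - m)]
  have h2 : m ^ 2 ≤ L ^ 2 * (p ^ 2 / T) := by
    calc m ^ 2 ≤ (L * (p / T)) ^ 2 := pow_le_pow_left₀ hm0 hm 2
      _ = L ^ 2 * (p ^ 2 / T) * (1 / T) := by field_simp
      _ ≤ L ^ 2 * (p ^ 2 / T) * 1 := by
          gcongr; exact (div_le_one hT0).2 hT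
      _ = _ := mul_one _
  have h3 : 3 * (1 + L + L ^ 2) * (p / T + s ^ 2 / p) * p =
      3 * (1 + L + L ^ 2) * (p ^ 2 / T + s ^ 2) := by field_simp
  rw [h3]
  refine h1.trans ?_
  have h4 : 0 ≤ p ^ 2 / T := by positivity
  nlinarith [mul_nonneg hL (sq_nonneg s), mul_nonneg (sq_nonneg L) (sq_nonneg s)]

/-- From a bound on the error of a factor up to sign to a bound on the error of its square. -/
lemma abs_sq_sub_sq_le {x f v a G L a₀ : ℝ} (hv : v ^ 2 = 1) (hG : 0 ≤ G) (ha : 0 ≤ a)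
    (ha₀ : a ≤ a₀) (hx : (x - v * f) ^ 2 ≤ G * a ^ 2) (hf : f ^ 2 ≤ L) :
    |x ^ 2 - f ^ 2| ≤ √G * (√G * a₀ + 2 * √L) * a := by
  have h1 : |x - v * f| ≤ √G * a := by
    rw [← Real.sqrt_sq ha, ← Real.sqrt_mul hG]
    exact Real.abs_le_sqrt hx
  have h2 : |v * f| ≤ √L := Real.abs_le_sqrt (by rw [mul_pow, hv, one_mul]; exact hf)
  -- Since `v ^ 2 = 1`, this is `(x - v * f) * (x + v * f)`: the square does not see the sign.
  have h3 : x ^ 2 - f ^ 2 = (x - v * f) * ((x - v * f) + 2 * (v * f)) := by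
    linear_combination f ^ 2 * hv
  rw [h3, abs_mul]
  have h4 : |(x - v * f) + 2 * (v * f)| ≤ √G * a₀ + 2 * √L := by
    refine (abs_add_le _ _).trans ?_
    rw [abs_mul 2, abs_two]
    have : √G * a ≤ √G * a₀ := by gcongr
    linarith
  calc |x - v * f| * |(x - v * f) + 2 * (v * f)| ≤ √G * a * (√G * a₀ + 2 * √L) := by gcongr
    _ = _ := by ring

lemma euclNorm_le_of_abs_le {n : ℕ} {x : Fin n → ℝ} {a : ℝ} (ha : 0 ≤ a) (h : ∀ i, |x i| ≤ a) :
    euclNorm x ≤ √n * a := by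
  rw [euclNorm, EuclideanSpace.norm_eq, ← Real.sqrt_sq ha, ← Real.sqrt_mul (Nat.cast_nonneg n)]
  refine Real.sqrt_le_sqrt ?_
  calc _ ≤ ∑ _i : Fin n, a ^ 2 := Finset.sum_le_sum fun i _ => by
        simpa using pow_le_pow_left₀ (abs_nonneg _) (h i) 2
    _ = _ := by simp

namespace FactorModel

/-- Outside an event of small probability both errors are bounded at the claimed rates. -/
theorem exists_rate_bounds (r : ℕ) {C c b ε : ℝ} (hc : 0 < c) (hb0 : 0 ≤ b) (hε : 0 < ε) :
    ∃ K₁ K₂ : ℝ, ∀ {p : ℕ} {Ω : Type*} [MeasurableSpace Ω] {P : Measure Ω} [IsProbabilityMeasure P]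
      (M : FactorModel r p Ω P), M.Moments C → ∀ {q s : ℝ}, q < 1 → M.Sparse q s → s ≤ b * p →
      0 < p → ∀ {T t : ℕ}, 1 ≤ t → t ≤ T → M.EigenGap T c → M.Ordered T →
      ∃ N : Set Ω, P N ≤ ENNReal.ofReal ε ∧ ∀ ω ∉ N, ∀ W : Matrix (Fin p) (Fin r) ℝ,
        IsPCALoading (M.sampleCov T ω) W →
        signedSqDist W M.V ≤ K₁ * ((p : ℝ) / T + s ^ 2 / p) ∧
        euclNorm (fun k => M.fHat T W t ω k ^ 2 - M.f t ω k ^ 2) ≤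
          K₂ * (1 / √(T : ℝ) + √(s / p)) := by
  -- The budget `ε` is shared by five Markov bounds. In `D`, `24 = 8 * 3` combines Davis-Kahan with
  -- the square of a three-term sum; in `G`, the `4` comes from a four-term sum, two of whose terms
  -- carry the loading error. None of these depends on the model.
  set L := momentBound r C b / (ε / 5)
  set D := 24 / c ^ 2 * (1 + L + L ^ 2)
  set G := 4 * (2 * (L * (D * (b + 1))) + L)
  set H := √G * (√G * (1 + √b) + 2 * √L)
  refine ⟨r * D, √r * H, ?_⟩
  intro p Ω _ P _ M hM q s hq1 hs hb hp T t ht htT hgap hord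
  have hT : 0 < T := by omega
  have hp' : (0 : ℝ) < p := by exact_mod_cast hp
  have hT1 : (1 : ℝ) ≤ T := by exact_mod_cast hT
  have hT' : (0 : ℝ) < T := by linarith
  have hrow := hM.row_sum_le hq1 hs
  have hs0 : 0 ≤ s := (Finset.sum_nonneg fun j _ => abs_nonneg _).trans (hrow ⟨0, hp⟩)
  obtain ⟨N, hN, hω⟩ := hM.exists_event hq1 hs hs0 hb0 hb hp hT ht (show 0 < ε / 5 by positivity)
  -- The added set, where gap or ordering fails, is null. The event is chosen before `W`, so the
  -- estimator need not be measurable.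
  refine ⟨N ∪ {ω | ¬ ((∀ k < r, c ≤ |eigDesc (M.SigmaFBar T ω) k -
    eigDesc (M.SigmaFBar T ω) (k + 1)|) ∧ Antitone fun k => M.SigmaFBar T ω k k)}, ?_, ?_⟩
  · refine (measure_union_le _ _).trans ?_
    rw [ae_iff.1 (hgap.and hord), add_zero]
    refine hN.trans_eq ?_
    congr 1; ring
  intro ω hωN W hW
  rw [Set.mem_union, not_or] at hωN
  obtain ⟨hf, hu, hv, hz, hn⟩ := hω ω hωN.1
  obtain ⟨hgapω, hordω⟩ := not_not.1 hωN.2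
  have hL0 : 0 ≤ L := (Finset.sum_nonneg fun k _ => sq_nonneg _).trans hf
  have hD0 : 0 ≤ D := by positivity
  have hG0 : 0 ≤ G := by positivity
  simp only [M.SigmaFBar_eq_diagonal, Matrix.diagonal_apply_eq] at hgapω hordω
  obtain ⟨hg1, hg2⟩ := gaps_of_consecutive_gaps hordω (M.hBar_nonneg ω) hgapω
  obtain ⟨σ, hσ⟩ := hW.exists_sign_sum_sq_le hp M.V_norm hordω hc hg1 hg2
    (M.norm_remainder_le hs0 hT hM.SigmaU_symm hrow ω)
  set η : ℝ := D * ((p : ℝ) / T + s ^ 2 / p) with hηdef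
  have hη : ∀ k, ∑ i, (W i k - ((σ k : ℤ) : ℝ) * M.V i k) ^ 2 ≤ η := by
    intro k
    refine (hσ k).trans ?_
    rw [div_le_iff₀ (by positivity)]
    have h1 := sq_remainder_le (s := s) hp' hT1 hL0 (Finset.sum_nonneg fun _ _ => sq_nonneg _)
      (Finset.sum_nonneg fun _ _ => sq_nonneg _) hn hz
    have h2 : η * (c ^ 2 * p) =
        8 * (3 * (1 + L + L ^ 2) * ((p : ℝ) / T + s ^ 2 / p) * p) := by
      simp only [hηdef, D]; field_simp; ring
    rw [h2]
    gcongr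
  have hη0 : 0 ≤ η := by positivity
  refine ⟨?_, ?_⟩
  · refine (signedSqDist_le_sum_sq W M.V σ).trans ?_
    calc _ ≤ ∑ _k : Fin r, η := Finset.sum_le_sum fun k _ => hη k
      _ = _ := by simp [hηdef, mul_assoc]
  · set a : ℝ := 1 / √(T : ℝ) + √(s / p) with ha
    have ha0 : 0 ≤ a := by positivity
    have hsp : s / p ≤ b := (div_le_iff₀ hp').2 hb
    have hsp0 : 0 ≤ s / p := by positivity
    have ha1 : a ≤ 1 + √b := by
      refine add_le_add ?_ (Real.sqrt_le_sqrt hsp)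
      rw [div_le_one (Real.sqrt_pos.2 hT')]
      exact Real.one_le_sqrt.2 hT1
    have ha2 : 1 / (T : ℝ) + s / p ≤ a ^ 2 := by
      have h1 : (1 / √(T : ℝ)) ^ 2 = 1 / T := by
        rw [div_pow, one_pow, Real.sq_sqrt hT'.le]
      have h2 : √(s / p) ^ 2 = s / p := Real.sq_sqrt hsp0
      have h3 : 0 ≤ 1 / √(T : ℝ) * √(s / p) := by positivity
      rw [ha, add_sq, h1, h2]
      linarith
    -- Here `s ≤ b * p` reduces the loading rate `(s / p) ^ 2` to `s / p`.
    have hηp : η ≤ D * (b + 1) * p * a ^ 2 := by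
      calc η = D * p * (1 / T + s / p * (s / p)) := by
            simp only [hηdef]; field_simp
        _ ≤ D * p * ((b + 1) * (1 / T + s / p)) := by
            have h0 : 0 ≤ 1 / (T : ℝ) := by positivity
            have h1 : s / p * (s / p) ≤ b * (s / p) := by gcongr
            have h2 : 0 ≤ b * (1 / (T : ℝ)) := by positivity
            gcongr
            linarith
        _ ≤ D * p * ((b + 1) * a ^ 2) := by gcongr
        _ = _ := by ring
    rw [mul_assoc]
    refine euclNorm_le_of_abs_le (by positivity) fun k => ?_
    have hfk : M.f t ω k ^ 2 ≤ L :=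
      (Finset.single_le_sum (f := fun k => M.f t ω k ^ 2) (fun _ _ => sq_nonneg _)
        (Finset.mem_univ k)).trans hf
    have hvk : (∑ i, M.V i k * M.u t ω i) ^ 2 ≤ L * (p * s) :=
      (Finset.single_le_sum (f := fun k => (∑ i, M.V i k * M.u t ω i) ^ 2)
        (fun _ _ => sq_nonneg _) (Finset.mem_univ k)).trans hv
    have hσ2 : (((σ k : ℤ) : ℝ)) ^ 2 = 1 := by
      rcases Int.units_eq_one_or (σ k) with h | h <;> simp [h]
    refine abs_sq_sub_sq_le hσ2 hG0 ha0 ha1 ?_ hfk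
    have h1 := M.sq_fHat_sub_le hT ht ω hp (hW.sum_sq k) (σ k) (hη k)
    rw [mul_pow] at h1
    refine le_of_mul_le_mul_left (h1.trans ?_) (pow_pos hp' 2)
    calc _ ≤ 4 * (D * (b + 1) * p * a ^ 2 * (p * L) + L * (p * s) +
          D * (b + 1) * p * a ^ 2 * (L * p) + p * (L * (p / T))) := by gcongr
      _ = 4 * (2 * (L * (D * (b + 1))) * a ^ 2 + L * (1 / T + s / p)) * p ^ 2 := by
          field_simp; ring
      _ ≤ 4 * (2 * (L * (D * (b + 1))) * a ^ 2 + L * a ^ 2) * p ^ 2 := by gcongr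
      _ = _ := by simp only [G]; ring

end FactorModel

end

/-! ### Passage to stochastic order along the filter. -/

theorem theoremS1 {ι : Type*} (l : Filter ι) {Ω : ι → Type*} [∀ i, MeasurableSpace (Ω i)]
    (P : ∀ i, Measure (Ω i)) [∀ i, IsProbabilityMeasure (P i)]
    (r : ℕ) (p T : ι → ℕ) (hp : Tendsto p l atTop) (hT : Tendsto T l atTop)
    (q : ℝ) (hq0 : 0 ≤ q) (hq1 : q < 1)
    (s : ℕ → ℝ) (hs : s =O[atTop] fun n : ℕ => (n : ℝ))
    (M : ∀ i, FactorModel r (p i) (Ω i) (P i))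
    (hsparse : ∀ i, (M i).Sparse q (s (p i)))
    (C c : ℝ) (hc : 0 < c)
    (hmom : ∀ i, (M i).Moments C)
    (hgap : ∀ i, (M i).EigenGap (T i) c)
    (hord : ∀ i, (M i).Ordered (T i))
    (Vhat : ∀ i, Ω i → Matrix (Fin (p i)) (Fin r) ℝ)
    (hVhat : ∀ i ω, IsPCALoading ((M i).sampleCov (T i) ω) (Vhat i ω)) :
    IsBigOp l P (fun i ω => signedSqDist (Vhat i ω) (M i).V)
      (fun i => (p i : ℝ) / (T i : ℝ) + s (p i) ^ 2 / (p i : ℝ)) ∧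
    ∀ t : ι → ℕ, (∀ᶠ i in l, 1 ≤ t i ∧ t i ≤ T i) →
      IsBigOp l P
        (fun i ω => euclNorm fun k =>
          (M i).fHat (T i) (Vhat i ω) (t i) ω k ^ 2 - (M i).f (t i) ω k ^ 2)
        (fun i => 1 / √(T i : ℝ) + √(s (p i) / (p i : ℝ))) := by
  obtain ⟨b, hb0, hb⟩ := hs.exists_nonneg
  have hsb : ∀ᶠ i in l, s (p i) ≤ b * p i := by
    filter_upwards [hp.eventually hb.bound] with i hi
    simpa using (le_abs_self _).trans hi
  have key : ∀ ε : ℝ, 0 < ε → ∃ K₁ K₂ : ℝ, ∀ t : ι → ℕ, (∀ᶠ i in l, 1 ≤ t i ∧ t i ≤ T i) →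
      ∀ᶠ i in l, ∃ N : Set (Ω i), P i N ≤ ENNReal.ofReal ε ∧ ∀ ω ∉ N,
        signedSqDist (Vhat i ω) (M i).V ≤ K₁ * ((p i : ℝ) / T i + s (p i) ^ 2 / p i) ∧
        euclNorm (fun k => (M i).fHat (T i) (Vhat i ω) (t i) ω k ^ 2 - (M i).f (t i) ω k ^ 2) ≤
          K₂ * (1 / √(T i : ℝ) + √(s (p i) / p i)) := by
    intro ε hε
    obtain ⟨K₁, K₂, h⟩ := FactorModel.exists_rate_bounds r (C := C) hc hb0 hε
    refine ⟨K₁, K₂, fun t ht => ?_⟩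
    filter_upwards [ht, hsb, hp.eventually_gt_atTop 0] with i hti hsi hpi
    obtain ⟨N, hN, hω⟩ := h (M i) (hmom i) hq1 (hsparse i) hsi hpi hti.1 hti.2 (hgap i) (hord i)
    exact ⟨N, hN, fun ω hωN => hω ω hωN _ (hVhat i ω)⟩
  refine ⟨fun ε hε => ?_, fun t ht ε hε => ?_⟩
  · obtain ⟨K₁, K₂, h⟩ := key ε hε
    refine ⟨K₁, ?_⟩
    -- The loading bound does not involve a time point; `1` is merely an admissible choice.
    filter_upwards [h (fun _ => 1) ((hT.eventually_ge_atTop 1).mono fun i hi => ⟨le_rfl, hi⟩)]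
      with i ⟨N, hN, hω⟩
    refine (measure_mono fun ω hlt => ?_).trans hN
    by_contra hωN
    rw [Set.mem_ofPred_eq, abs_of_nonneg (signedSqDist_nonneg _ _)] at hlt
    exact absurd (hω ω hωN).1 (not_le.2 hlt)
  · obtain ⟨K₁, K₂, h⟩ := key ε hε
    refine ⟨K₂, ?_⟩
    filter_upwards [h t ht] with i ⟨N, hN, hω⟩
    refine (measure_mono fun ω hlt => ?_).trans hN
    by_contra hωN
    rw [Set.mem_ofPred_eq, abs_of_nonneg (show 0 ≤ euclNorm _ from norm_nonneg _)] at hlt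
    exact absurd (hω ω hωN).2 (not_le.2 hlt)
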